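/- Let $k$ be an algebraically closed field of characteristic zero, let $T=\mathbb{G}_m^2$ be the torus over $k$ with coordinate ring $k[x^{\pm1},y^{\pm1}]$, and let $e=(1,1)\in T$. We say that $f\in k[x^{\pm1},y^{\pm1}]$ defines a negative curve vanishing to order $m$ at $e$ if $f$ is irreducible, vanishes at $e$ to order exactly $m$, and its Newton polygon lies in some nondegenerate triangle of area at most $m^2/2$. Two curves in $T$ are isomorphic if some automorphism of the variety $T$ carries one to the other. Let $M,N\ge 0$ and $K\ge 3$ be integers with $(M+N)^2=KMN+1$. Let $IT(M,N)$ be the (possibly degenerate) triangle with vertices $(0,0)$, $(M+N,KN)$, $(M,0)$, and let $RT(M,N)$ be the triangle with vertices $(0,0)$, $(M,M+N)$, $\left(M-\frac{M+N}{K},0\right)$. 1. The triangle $IT(M,N)$ has area at most $(M+N)^2/2$ and contains the Newton polygon of a polynomial defining a negative curve that vanishes to order $M+N$ at $e$. If $M>0$, the triangle $RT(M,N)$ has area at most $M^2/2$ and contains the Newton polygon of a polynomial defining a negative curve that vanishes to order $M$ at $e$. 2. Consider the triangles $IT(M,N)$ for all solutions with $M\ge N>0$ and $RT(M,N)$ for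 all solutions with $M>N>1$ (here $K\geq 3$ varies; it is determined by $M$ and $N$). The negative curves of part 1 (of order $M+N$ in $IT(M,N)$, respectively of order $M$ in $RT(M,N)$) belonging to two different triangles of this list are never isomorphic. -/

import Mathlib

namespace NegativeCurves

noncomputable section

/-- The ring `k[x^{±1}, y^{±1}]`, the coordinate ring of the torus `T = 𝔾ₘ²` over `k`;
the lattice point `(a, b)` stands for the monomial `x^a y^b`. -/
abbrev LaurentRing (k : Type*) [Field k] : Type _ := AddMonoidAlgebra k (ℤ × ℤ)

/-- The ideal `(x - 1, y - 1)` of the point `e = (1, 1)` of the torus. -/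
def idealE (k : Type*) [Field k] : Ideal (LaurentRing k) :=
  Ideal.span {AddMonoidAlgebra.single (1, 0) 1 - 1, AddMonoidAlgebra.single (0, 1) 1 - 1}

/-- `f` vanishes at `e = (1, 1)` to order exactly `m`. -/
def VanishesToOrder {k : Type*} [Field k] (f : LaurentRing k) (m : ℕ) : Prop :=
  f ∈ idealE k ^ m ∧ f ∉ idealE k ^ (m + 1)

/-- The Newton polygon: the convex hull in `ℝ²` of the exponents of the monomials of `f`. -/
def newtonPolygon {k : Type*} [Field k] (f : LaurentRing k) : Set (ℝ × ℝ) :=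
  convexHull ℝ ((fun u : ℤ × ℤ => ((u.1 : ℝ), (u.2 : ℝ))) '' (f.coeff.support : Set (ℤ × ℤ)))

/-- A possibly degenerate triangle in the plane, given by its three vertices. -/
structure PlaneTriangle where
  p : ℝ × ℝ
  q : ℝ × ℝ
  r : ℝ × ℝ

/-- The closed region bounded by the triangle. -/
def PlaneTriangle.region (D : PlaneTriangle) : Set (ℝ × ℝ) :=
  convexHull ℝ {D.p, D.q, D.r}

/-- The area of the triangle. -/
def PlaneTriangle.area (D : PlaneTriangle) : ℝ :=
  |(D.q.1 - D.p.1) * (D.r.2 - D.p.2) - (D.r.1 - D.p.1) * (D.q.2 - D.p.2)| / 2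

/-- `f` defines a negative curve in the torus with vanishing order `m` at `e`: it is irreducible,
vanishes to order `m` at `e`, and its Newton polygon fits into some (nondegenerate) triangle of
area at most `m² / 2`. -/
def DefinesNegativeCurve {k : Type*} [Field k] (f : LaurentRing k) (m : ℕ) : Prop :=
  Irreducible f ∧ VanishesToOrder f m ∧
    ∃ D : PlaneTriangle, 0 < D.area ∧ D.area ≤ (m : ℝ) ^ 2 / 2 ∧ newtonPolygon f ⊆ D.region

/-- The triangle `D`, of area at most `m² / 2`, supports the polynomial `f`, and `f` defines a
negative curve that vanishes to order `m` at `e`. -/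
def SupportsNegativeCurve {k : Type*} [Field k] (D : PlaneTriangle) (m : ℕ)
    (f : LaurentRing k) : Prop :=
  D.area ≤ (m : ℝ) ^ 2 / 2 ∧ newtonPolygon f ⊆ D.region ∧ DefinesNegativeCurve f m

/-- Some automorphism of the torus (as a variety over `k`, that is, a `k`-algebra automorphism of
its coordinate ring) carries the curve `f = 0` to the curve `g = 0`. -/
def IsomorphicCurves {k : Type*} [Field k] (f g : LaurentRing k) : Prop :=
  ∃ σ : LaurentRing k ≃ₐ[k] LaurentRing k,
    Ideal.map (σ : LaurentRing k →+* LaurentRing k) (Ideal.span {f}) = Ideal.span {g}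

/-- The triples `M, N ≥ 0`, `K ≥ 3` with `(M + N)² = K M N + 1`. -/
def IsSolution (M N K : ℕ) : Prop :=
  3 ≤ K ∧ (M + N) ^ 2 = K * M * N + 1

/-- The integral triangle. -/
def IT (M N K : ℕ) : PlaneTriangle where
  p := (0, 0)
  q := ((M : ℝ) + N, (K : ℝ) * N)
  r := ((M : ℝ), 0)

/-- The rational triangle. -/
def RT (M N K : ℕ) : PlaneTriangle where
  p := (0, 0)
  q := ((M : ℝ), (M : ℝ) + N)
  r := ((M : ℝ) - ((M : ℝ) + N) / K, 0)

end

end NegativeCurves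

/-!
Consider a triangle with vertices `(0, 0)`, `(m, n)` and `(m - n / K, 0)`, where `m` and `n` are
coprime. The equation `(M + N)² = K M N + 1` puts its area so close to `m² / 2` that its columns
contain `1, 1, 2, …, m` lattice points in some order. These are more than `m (m + 1) / 2` points,
so some nonzero `f` supported on them vanishes to order `m` at `e`. Vanishing to order `m` is the
vanishing of the moments `∑ coeff u * p u` for all polynomials `p` of degree less than `m`;
choosing `p` as a product of linear forms that kills all but one point shows that no column can be
missing from the support of `f`. Hence both ends of the upper edge occur in `f`. As this edge is
primitive and spans the full width of the triangle, `f` is irreducible, and the vanishing order is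
exactly `m`.

An automorphism of the torus acts on supports by an affine automorphism of `ℤ²`. A negative curve
of order `m ≥ 2` has width at least `m` in every lattice direction, and the width of our supports
is exactly `m` only in the directions `(1, 0)`, and possibly `(-1, 1)` and `(-2, 1)`. An affine map
identifying two supports therefore has one of a few explicit matrices, and following the two ends
of the upper edge shows that `m` and `n` are invariants of the curve.
-/

namespace NegativeCurves

open AddMonoidAlgebra

section Supports

theorem exists_mem_support_mul_forall_add_le {R A Γ : Type*} [Semiring R] [NoZeroDivisors R]
    [AddZeroClass A] [UniqueSums A] [AddCommMonoid Γ] [LinearOrder Γ] [IsOrderedCancelAddMonoid Γ]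
    (p : A →+ Γ) {g h : AddMonoidAlgebra R A} (hg : g ≠ 0) (hh : h ≠ 0) :
    ∃ w ∈ (g * h).coeff.support, ∀ u ∈ g.coeff.support, ∀ v ∈ h.coeff.support,
      p u + p v ≤ p w := by
  obtain ⟨a, ha, ha_max⟩ := g.coeff.support.exists_max_image p (by simpa using hg)
  obtain ⟨b, hb, hb_max⟩ := h.coeff.support.exists_max_image p (by simpa using hh)
  obtain ⟨u, hu, v, hv, huv⟩ := UniqueSums.uniqueAdd_of_nonempty
    (A := {u ∈ g.coeff.support | p u = p a}) (B := {v ∈ h.coeff.support | p v = p b})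
    ⟨a, by simpa using ha⟩ ⟨b, by simpa using hb⟩
  rw [Finset.mem_filter] at hu hv
  have hunique : UniqueAdd g.coeff.support h.coeff.support u v := by
    intro u' v' hu' hv' heq
    have hp : p u' + p v' = p a + p b := by rw [← map_add, heq, map_add, hu.2, hv.2]
    obtain ⟨hpu, hpv⟩ := (add_eq_add_iff_eq_and_eq (ha_max u' hu') (hb_max v' hv')).1 hp
    exact huv (Finset.mem_filter.2 ⟨hu', hpu⟩) (Finset.mem_filter.2 ⟨hv', hpv⟩) heq
  refine ⟨u + v, ?_, fun u' hu' v' hv' => ?_⟩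
  · rw [Finsupp.mem_support_iff, coeff_mul_add_of_uniqueAdd hunique]
    exact mul_ne_zero (Finsupp.mem_support_iff.1 hu.1) (Finsupp.mem_support_iff.1 hv.1)
  · rw [map_add, hu.2, hv.2]
    exact add_le_add (ha_max u' hu') (hb_max v' hv')

theorem exists_add_eq_of_mem_support_mul {R A : Type*} [Semiring R] [Add A]
    {g h : AddMonoidAlgebra R A} {w : A} (hw : w ∈ (g * h).coeff.support) :
    ∃ u ∈ g.coeff.support, ∃ v ∈ h.coeff.support, u + v = w := by
  classical
  exact Finset.mem_add.1 (support_coeff_mul_subset g h hw)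

theorem exists_eq_single_of_support_subsingleton {R A : Type*} [Semiring R]
    {g : AddMonoidAlgebra R A} (hg : g ≠ 0) (hsub : (g.coeff.support : Set A).Subsingleton) :
    ∃ u, ∃ c ≠ 0, g = single u c := by
  classical
  obtain ⟨u, hu⟩ : g.coeff.support.Nonempty := by simpa using hg
  refine ⟨u, g.coeff u, Finsupp.mem_support_iff.1 hu, ?_⟩
  ext v
  rw [coeff_single, Finsupp.single_apply]
  split_ifs with huv
  · rw [huv]
  · by_contra hv
    exact huv (hsub hu (Finsupp.mem_support_iff.2 hv))

theorem isUnit_single {R A : Type*} [DivisionRing R] [AddGroup A] (u : A) {c : R} (hc : c ≠ 0) :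
    IsUnit (single u c : AddMonoidAlgebra R A) :=
  isUnit_iff_exists.2 ⟨single (-u) c⁻¹, by simp [single_mul_single, one_def, hc],
    by simp [single_mul_single, one_def, hc]⟩

variable {k : Type*} [Field k]

theorem exists_eq_single_of_isUnit {g : LaurentRing k} (hg : IsUnit g) :
    ∃ u, ∃ c ≠ 0, g = single u c := by
  obtain ⟨h, hgh⟩ := hg.exists_right_inv
  have hh : h ≠ 0 := right_ne_zero_of_mul_eq_one hgh
  have hle (p : ℤ × ℤ →+ ℤ) : ∀ u ∈ g.coeff.support, ∀ v ∈ h.coeff.support, p u + p v ≤ 0 := by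
    obtain ⟨w, hw, hmax⟩ := exists_mem_support_mul_forall_add_le p hg.ne_zero hh
    rw [hgh, one_def, coeff_single] at hw
    have hw0 : w = 0 := Finset.mem_singleton.1 (Finsupp.support_single_subset hw)
    simpa [hw0] using hmax
  obtain ⟨v, hv⟩ : h.coeff.support.Nonempty := by simpa using hh
  refine exists_eq_single_of_support_subsingleton hg.ne_zero fun u hu u' hu' => ?_
  have hneg : ∀ u ∈ g.coeff.support, u = -v := by
    intro u hu
    have h₁ := hle (.fst ℤ ℤ) u hu v hv
    have h₂ := hle (-.fst ℤ ℤ) u hu v hv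
    have h₃ := hle (.snd ℤ ℤ) u hu v hv
    have h₄ := hle (-.snd ℤ ℤ) u hu v hv
    simp only [AddMonoidHom.neg_apply, AddMonoidHom.coe_fst, AddMonoidHom.coe_snd] at h₁ h₂ h₃ h₄
    ext <;> simp only [Prod.fst_neg, Prod.snd_neg] <;> omega
  rw [hneg u hu, hneg u' hu']

/-- The set `S` lies in the strip `0 ≤ x ≤ m`, below a primitive segment that joins its only point
`(0, 0)` on the line `x = 0` to its point `(m, n)`: the shape of support that forces
irreducibility. -/
structure HasPrimitiveUpperEdge (S : Set (ℤ × ℤ)) (m n : ℤ) : Prop where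
  pos : 0 < m
  coprime : IsCoprime m n
  zero_mem : (0, 0) ∈ S
  corner_mem : (m, n) ∈ S
  fst_nonneg : ∀ u ∈ S, 0 ≤ u.1
  fst_le : ∀ u ∈ S, u.1 ≤ m
  below : ∀ u ∈ S, m * u.2 ≤ n * u.1
  snd_eq_zero : ∀ u ∈ S, u.1 = 0 → u.2 = 0

theorem exists_eq_mul_of_mul_eq_mul {m n x y : ℤ} (hm : m ≠ 0) (hmn : IsCoprime m n)
    (h : m * y = n * x) : ∃ d, x = d * m ∧ y = d * n := by
  obtain ⟨d, rfl⟩ := hmn.dvd_of_dvd_mul_left ⟨y, h.symm⟩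
  exact ⟨d, mul_comm _ _, mul_left_cancel₀ hm (by linarith)⟩

namespace HasPrimitiveUpperEdge

variable {m n : ℤ} {g h : LaurentRing k}

theorem exists_gap (hS : HasPrimitiveUpperEdge ((g * h).coeff.support : Set (ℤ × ℤ)) m n)
    (hg : g ≠ 0) (hh : h ≠ 0) :
    (∃ u ∈ g.coeff.support, ∃ u' ∈ g.coeff.support, u'.1 - u.1 = m) ∨
      ∃ v ∈ h.coeff.support, ∃ v' ∈ h.coeff.support, v'.1 - v.1 = m := by
  obtain ⟨s, hs, t, ht, hst⟩ := exists_add_eq_of_mem_support_mul hS.zero_mem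
  obtain ⟨s', hs', t', ht', hst'⟩ := exists_add_eq_of_mem_support_mul hS.corner_mem
  rw [Prod.ext_iff] at hst hst'
  simp only [Prod.fst_add, Prod.snd_add] at hst hst'
  let height : ℤ × ℤ →+ ℤ := m • .snd ℤ ℤ - n • .fst ℤ ℤ
  have height_eq (u : ℤ × ℤ) : height u = m * u.2 - n * u.1 := by simp [height]
  obtain ⟨w, hw, hw_max⟩ := exists_mem_support_mul_forall_add_le height hg hh
  have hw_below := hS.below w hw
  have hsum : height s + height t = 0 := by
    rw [height_eq, height_eq]; linear_combination m * hst.2 - n * hst.1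
  have hsum' : height s' + height t' = 0 := by
    rw [height_eq, height_eq]; linear_combination m * hst'.2 - n * hst'.1
  have heq : height s' = height s := by
    have h₁ := hw_max s' hs' t ht
    have h₂ := hw_max s hs t' ht'
    rw [height_eq w] at h₁ h₂
    linarith
  rw [height_eq, height_eq] at heq
  obtain ⟨d, hd, -⟩ := exists_eq_mul_of_mul_eq_mul (x := s'.1 - s.1)
    (y := s'.2 - s.2) hS.pos.ne' hS.coprime (by linarith)
  obtain ⟨a, ha, ha_max⟩ := exists_mem_support_mul_forall_add_le (.fst ℤ ℤ) hg hh
  obtain ⟨b, hb, hb_max⟩ := exists_mem_support_mul_forall_add_le (-.fst ℤ ℤ) hg hh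
  simp only [AddMonoidHom.neg_apply, AddMonoidHom.coe_fst] at ha_max hb_max
  have hwidth : a.1 - b.1 ≤ m := by linarith [hS.fst_le a ha, hS.fst_nonneg b hb]
  have hd_le : d ≤ 1 := by
    nlinarith [hS.pos, ha_max s' hs' t ht, hb_max s hs t' ht']
  have hd_nonneg : 0 ≤ d := by
    nlinarith [hS.pos, ha_max s hs t' ht', hb_max s' hs' t ht]
  obtain rfl | rfl : d = 0 ∨ d = 1 := by omega
  · exact Or.inr ⟨t, ht, t', ht', by linarith⟩
  · exact Or.inl ⟨s, hs, s', hs', by linarith⟩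

theorem isUnit_of_gap (hS : HasPrimitiveUpperEdge ((g * h).coeff.support : Set (ℤ × ℤ)) m n)
    (hg : g ≠ 0) (hh : h ≠ 0) {u u' : ℤ × ℤ} (hu : u ∈ g.coeff.support)
    (hu' : u' ∈ g.coeff.support) (hgap : u'.1 - u.1 = m) : IsUnit h := by
  obtain ⟨s, hs, t, ht, hst⟩ := exists_add_eq_of_mem_support_mul hS.zero_mem
  rw [Prod.ext_iff] at hst
  simp only [Prod.fst_add, Prod.snd_add] at hst
  have same_column : ∀ v ∈ h.coeff.support, v.1 = t.1 := by
    intro v hv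
    obtain ⟨a, ha, ha_max⟩ := exists_mem_support_mul_forall_add_le (.fst ℤ ℤ) hg hh
    obtain ⟨b, hb, hb_max⟩ := exists_mem_support_mul_forall_add_le (-.fst ℤ ℤ) hg hh
    simp only [AddMonoidHom.neg_apply, AddMonoidHom.coe_fst] at ha_max hb_max
    linarith [hS.fst_le a ha, hS.fst_nonneg b hb, ha_max u' hu' v hv, hb_max u hu t ht,
      ha_max u' hu' t ht, hb_max u hu v hv]
  -- `(0, 0)` is both the lowest and the highest point of `g * h` on its leftmost column.
  have snd_le (ε : ℤ) : ∀ v ∈ h.coeff.support, ε * (s.2 + v.2) ≤ 0 := by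
    intro v hv
    let p : ℤ × ℤ →+ ℤ ×ₗ ℤ :=
      AddMonoidHom.mk' (fun u => toLex (-u.1, ε * u.2)) fun u v => by
        simp only [Prod.fst_add, Prod.snd_add, neg_add, mul_add, ← toLex_add, Prod.mk_add_mk]
    obtain ⟨w, hw, hmax⟩ := exists_mem_support_mul_forall_add_le p hg hh
    have hv_le : -(s + v).1 < -w.1 ∨ -(s + v).1 = -w.1 ∧ ε * (s + v).2 ≤ ε * w.2 :=
      Prod.Lex.toLex_le_toLex.1 ((map_add p s v).trans_le (hmax s hs v hv))
    have hw₁ := hS.fst_nonneg w hw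
    have hcol := same_column v hv
    simp only [Prod.fst_add, Prod.snd_add] at hv_le
    have hw0 : w.1 = 0 := by omega
    rw [hS.snd_eq_zero w hw hw0] at hv_le
    omega
  obtain ⟨v, c, hc, rfl⟩ := exists_eq_single_of_support_subsingleton hh fun v hv v' hv' => by
    have h₁ := snd_le 1 v hv
    have h₂ := snd_le (-1) v hv
    have h₃ := snd_le 1 v' hv'
    have h₄ := snd_le (-1) v' hv'
    exact Prod.ext (by rw [same_column v hv, same_column v' hv']) (by omega)
  exact isUnit_single v hc

theorem irreducible {f : LaurentRing k}
    (hS : HasPrimitiveUpperEdge (f.coeff.support : Set (ℤ × ℤ)) m n) : Irreducible f := by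
  have hf : f ≠ 0 := by rintro rfl; simpa using hS.zero_mem
  refine ⟨fun hunit => ?_, fun g h hgh => ?_⟩
  · obtain ⟨u, c, -, rfl⟩ := exists_eq_single_of_isUnit hunit
    have h₀ := Finsupp.support_single_subset hS.zero_mem
    have h₁ := Finsupp.support_single_subset hS.corner_mem
    have heq := (Finset.mem_singleton.1 h₀).trans (Finset.mem_singleton.1 h₁).symm
    exact hS.pos.ne (congrArg Prod.fst heq)
  · subst hgh
    have hg := left_ne_zero_of_mul hf
    have hh := right_ne_zero_of_mul hf
    rcases hS.exists_gap hg hh with ⟨u, hu, u', hu', hgap⟩ | ⟨v, hv, v', hv', hgap⟩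
    · exact Or.inr (hS.isUnit_of_gap hg hh hu hu' hgap)
    · rw [mul_comm] at hS
      exact Or.inl (hS.isUnit_of_gap hh hg hv hv' hgap)

end HasPrimitiveUpperEdge

end Supports

section Automorphisms

variable {k : Type*} [Field k]

theorem exists_addMonoidHom_map_single (σ : LaurentRing k →ₐ[k] LaurentRing k) :
    ∃ (A : ℤ × ℤ →+ ℤ × ℤ) (χ : ℤ × ℤ → k), (∀ u, χ u ≠ 0) ∧
      ∀ u c, σ (single u c) = single (A u) (c * χ u) := by
  have monomial (u : ℤ × ℤ) : ∃ v, ∃ c ≠ 0, σ (single u 1) = single v c :=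
    exists_eq_single_of_isUnit ((isUnit_single u one_ne_zero).map σ)
  choose A χ hχ hA using monomial
  have map_add (u v) : A (u + v) = A u + A v := by
    have h : σ (single (u + v) 1) = σ (single u 1) * σ (single v 1) := by
      rw [← map_mul, single_mul_single, one_mul]
    rw [hA, hA, hA, single_mul_single, single_inj] at h
    exact (h.resolve_right fun h₀ => hχ _ h₀.1).1
  refine ⟨AddMonoidHom.mk' A map_add, χ, hχ, fun u c => ?_⟩
  have hsmul : (single u c : LaurentRing k) = c • single u 1 := by simp [smul_single]
  rw [hsmul, map_smul, hA, smul_single]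
  rfl

theorem exists_addEquiv_map_single (σ : LaurentRing k ≃ₐ[k] LaurentRing k) :
    ∃ (A : ℤ × ℤ ≃+ ℤ × ℤ) (χ : ℤ × ℤ → k), (∀ u, χ u ≠ 0) ∧
      ∀ u c, σ (single u c) = single (A u) (c * χ u) := by
  have left_inverse {τ τ' : LaurentRing k →ₐ[k] LaurentRing k} (h : ∀ f, τ' (τ f) = f)
      {A B : ℤ × ℤ →+ ℤ × ℤ} {χ ψ : ℤ × ℤ → k} (hχ : ∀ u, χ u ≠ 0) (hψ : ∀ u, ψ u ≠ 0)
      (hA : ∀ u c, τ (single u c) = single (A u) (c * χ u))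
      (hB : ∀ u c, τ' (single u c) = single (B u) (c * ψ u)) : B.comp A = .id _ := by
    ext1 u
    have hu := h (single u 1)
    rw [hA, hB, one_mul, single_inj] at hu
    exact (hu.resolve_right fun h₀ => mul_ne_zero (hχ _) (hψ _) h₀.1).1
  obtain ⟨A, χ, hχ, hA⟩ := exists_addMonoidHom_map_single (σ : LaurentRing k →ₐ[k] LaurentRing k)
  obtain ⟨B, ψ, hψ, hB⟩ :=
    exists_addMonoidHom_map_single (σ.symm : LaurentRing k →ₐ[k] LaurentRing k)
  exact ⟨A.toAddEquiv B (left_inverse σ.symm_apply_apply hχ hψ hA hB)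
    (left_inverse σ.apply_symm_apply hψ hχ hB hA), χ, hχ, hA⟩

theorem IsomorphicCurves.exists_affineEquiv {f g : LaurentRing k} (h : IsomorphicCurves f g) :
    ∃ φ : (ℤ × ℤ) ≃ᵃ[ℤ] (ℤ × ℤ), ∀ u, φ u ∈ g.coeff.support ↔ u ∈ f.coeff.support := by
  obtain ⟨σ, hσ⟩ := h
  obtain ⟨A, χ, hχ, hA⟩ := exists_addEquiv_map_single σ
  have coeff_map (f : LaurentRing k) (u) : (σ f).coeff (A u) = f.coeff u * χ u := by
    induction f using AddMonoidAlgebra.induction_linear with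
    | zero => simp
    | add f g hf hg => simp [hf, hg, add_mul]
    | single v c =>
      by_cases hvu : v = u
      · simp [hA, hvu]
      · simp [hA, hvu, A.injective.ne hvu]
  rw [Ideal.map_span, Set.image_singleton, Ideal.span_singleton_eq_span_singleton] at hσ
  obtain ⟨unit, hunit⟩ := hσ
  obtain ⟨v, c, hc, hv⟩ := exists_eq_single_of_isUnit unit.isUnit
  have hg : g = σ f * single v c := by rw [← hv]; exact hunit.symm
  refine ⟨A.toIntLinearEquiv.toAffineEquiv.trans (AffineEquiv.constVAdd ℤ (ℤ × ℤ) v),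
    fun u => ?_⟩
  have hφ : (A.toIntLinearEquiv.toAffineEquiv.trans (AffineEquiv.constVAdd ℤ (ℤ × ℤ) v)) u
      = A u + v := add_comm _ _
  rw [hφ, Finsupp.mem_support_iff, Finsupp.mem_support_iff, hg, coeff_mul_single_apply,
    add_neg_cancel_right, coeff_map]
  simp [hc, hχ]

end Automorphisms

section Moments

open scoped fwdDiff

/-- The moment `∑ c_u p(u)` of `∑ c_u x^u` against the function `p`. -/
noncomputable def moment {R A : Type*} [CommSemiring R] (p : A → R) :
    AddMonoidAlgebra R A →ₗ[R] R :=
  Finsupp.linearCombination R p ∘ₗ (coeffLinearEquiv R).toLinearMap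

/-- The functions on `A` that are polynomial of degree less than `m`, in the sense that all their
`m`-fold iterated differences vanish. -/
def degreeLT (R A : Type*) [CommRing R] [AddCommMonoid A] : ℕ → Submodule R (A → R)
  | 0 => ⊥
  | m + 1 =>
    { carrier := {p | ∀ v, Δ_[v] p ∈ degreeLT R A m}
      zero_mem' := fun v => by
        have h : Δ_[v] (0 : A → R) = 0 := fwdDiff_const v 0
        rw [h]
        exact zero_mem _
      add_mem' := fun hp hq v => by
        rw [fwdDiff_add]
        exact add_mem (hp v) (hq v)
      smul_mem' := fun c p hp v => by
        rw [fwdDiff_const_smul]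
        exact Submodule.smul_mem _ c (hp v) }

/-- All moments of `f` of degree less than `m` vanish: the linear conditions that express vanishing
to order `m` at the identity. -/
def HasVanishingMoments {R A : Type*} [CommRing R] [AddCommMonoid A] (m : ℕ)
    (f : AddMonoidAlgebra R A) : Prop :=
  ∀ p ∈ degreeLT R A m, moment p f = 0

section General

variable {R A B : Type*} [CommRing R]

theorem moment_single (p : A → R) (u : A) (c : R) : moment p (single u c) = c * p u := by
  simp [moment]

theorem moment_eq_sum (p : A → R) (f : AddMonoidAlgebra R A) :
    moment p f = ∑ u ∈ f.coeff.support, f.coeff u * p u :=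
  Finsupp.linearCombination_apply R f.coeff

theorem moment_mapDomain (φ : A → B) (p : B → R) (f : AddMonoidAlgebra R A) :
    moment p (mapDomain φ f) = moment (p ∘ φ) f :=
  Finsupp.linearCombination_mapDomain R φ f.coeff

variable [AddCommMonoid A] [AddCommMonoid B]

theorem moment_single_sub_one_mul (p : A → R) (v : A) (f : AddMonoidAlgebra R A) :
    moment p ((single v 1 - 1) * f) = moment (Δ_[v] p) f := by
  induction f using AddMonoidAlgebra.induction_linear with
  | zero => simp
  | add f g hf hg => rw [mul_add, map_add, map_add, hf, hg]
  | single u c =>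
    rw [sub_mul, one_mul, single_mul_single, one_mul, map_sub, moment_single, moment_single,
      moment_single, add_comm v u, ← mul_sub]
    rfl

theorem degreeLT_mono : Monotone (degreeLT R A) := by
  refine monotone_nat_of_le_succ fun m => ?_
  induction m with
  | zero => exact bot_le
  | succ m ih => exact fun p hp v => ih (hp v)

theorem one_mem_degreeLT : (fun _ => 1 : A → R) ∈ degreeLT R A 1 := by
  intro v
  rw [fwdDiff_const]
  exact zero_mem _

theorem comp_mem_degreeLT (φ : A →+ B) {m : ℕ} {p : B → R} (hp : p ∈ degreeLT R B m) :
    p ∘ φ ∈ degreeLT R A m := by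
  induction m generalizing p with
  | zero =>
    obtain rfl : p = 0 := hp
    exact zero_mem _
  | succ m ih =>
    intro v
    have h : Δ_[v] (p ∘ φ) = Δ_[φ v] p ∘ φ := by ext u; simp [fwdDiff]
    rw [h]
    exact ih (hp (φ v))

theorem sub_mul_mem_degreeLT (φ : A →+ ℤ) (c : ℤ) {m : ℕ} {p : A → R}
    (hp : p ∈ degreeLT R A m) : (fun u => ((φ u - c : ℤ) : R) * p u) ∈ degreeLT R A (m + 1) := by
  induction m generalizing c p with
  | zero =>
    obtain rfl : p = 0 := hp
    simp only [Pi.zero_apply, mul_zero]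
    exact zero_mem _
  | succ m ih =>
    intro v
    have leibniz : Δ_[v] (fun u => ((φ u - c : ℤ) : R) * p u) =
        (fun u => ((φ u - (c - φ v) : ℤ) : R) * Δ_[v] p u) + (φ v : R) • p := by
      ext u
      simp only [fwdDiff, map_add, Pi.add_apply, Pi.smul_apply, smul_eq_mul]
      push_cast
      ring
    rw [leibniz]
    exact add_mem (ih _ (hp v)) (Submodule.smul_mem _ _ hp)

theorem prod_sub_mem_degreeLT {ι : Type*} (s : Finset ι) (φ : ι → A →+ ℤ) (c : ι → ℤ) :
    (fun u => ∏ i ∈ s, ((φ i u - c i : ℤ) : R)) ∈ degreeLT R A (s.card + 1) := by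
  classical
  induction s using Finset.induction_on with
  | empty => exact one_mem_degreeLT
  | insert i s hi ih =>
    simp only [Finset.prod_insert hi, Finset.card_insert_of_notMem hi]
    exact sub_mul_mem_degreeLT (φ i) (c i) ih

namespace HasVanishingMoments

variable {m : ℕ} {f : AddMonoidAlgebra R A}

theorem mapDomain (hf : HasVanishingMoments m f) (φ : A →+ B) :
    HasVanishingMoments m (mapDomain φ f) := fun p hp => by
  rw [moment_mapDomain]
  exact hf _ (comp_mem_degreeLT φ hp)

/-- A product of fewer than `m` linear factors that vanishes on all exponents but `u` isolates the
coefficient at `u`. -/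
theorem coeff_eq_zero_of_isolated [IsDomain R] [CharZero R] (hf : HasVanishingMoments m f)
    {ι : Type*} {s : Finset ι} (hs : s.card < m) (φ : ι → A →+ ℤ) (c : ι → ℤ) {u : A}
    (hu : ∀ i ∈ s, φ i u ≠ c i)
    (hsupp : ∀ v ∈ f.coeff.support, v ≠ u → ∃ i ∈ s, φ i v = c i) : f.coeff u = 0 := by
  have hzero := hf _ (degreeLT_mono hs (prod_sub_mem_degreeLT s φ c))
  rw [moment_eq_sum, Finset.sum_eq_single u] at hzero
  · refine (mul_eq_zero.1 hzero).resolve_right (Finset.prod_ne_zero_iff.2 fun i hi => ?_)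
    exact Int.cast_ne_zero.2 (sub_ne_zero.2 (hu i hi))
  · intro v hv hvu
    obtain ⟨i, hi, hvi⟩ := hsupp v hv hvu
    rw [Finset.prod_eq_zero hi (by rw [hvi, sub_self, Int.cast_zero]), mul_zero]
  · intro hu
    rw [Finsupp.notMem_support_iff.1 hu, zero_mul]

end HasVanishingMoments

end General

variable {k : Type*} [Field k]

theorem hasVanishingMoments_of_mem_idealE_pow {m : ℕ} {f : LaurentRing k}
    (hf : f ∈ idealE k ^ m) : HasVanishingMoments m f := by
  induction m generalizing f with
  | zero =>
    rintro p rfl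
    simp [moment_eq_sum]
  | succ m ih =>
    intro p hp
    rw [pow_succ'] at hf
    refine Submodule.mul_induction_on hf (fun g hg h hh => ?_) fun g h hg hh => ?_
    · obtain ⟨a, b, rfl⟩ := Ideal.mem_span_pair.1 hg
      rw [add_mul, mul_comm a, mul_comm b, mul_assoc, mul_assoc, map_add,
        moment_single_sub_one_mul, moment_single_sub_one_mul,
        ih (Ideal.mul_mem_left _ _ hh) _ (hp _), ih (Ideal.mul_mem_left _ _ hh) _ (hp _),
        add_zero]
    · rw [map_add, hg, hh, add_zero]

end Moments

section DimensionCount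

variable {k : Type*} [Field k]

/-- The image of the monomials `(x - 1)^i (y - 1)^j`, `i + j < m`, in the ring of `(m - 1)`-jets
at `e`. -/
def jetMonomials (k : Type*) [Field k] (m : ℕ) : Set (LaurentRing k ⧸ idealE k ^ m) :=
  (fun p : Σ _ : ℕ, ℕ => Ideal.Quotient.mk _
    ((single (1, 0) 1 - 1) ^ p.1 * (single (0, 1) 1 - 1) ^ p.2)) ''
      ((Finset.range m).sigma fun i => Finset.range (m - i) : Finset (Σ _ : ℕ, ℕ))

theorem mk_single_mem_span_jetMonomials (m a b : ℕ) :
    Ideal.Quotient.mk (idealE k ^ m) (single ((a : ℤ), (b : ℤ)) 1) ∈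
      Submodule.span k (jetMonomials k m) := by
  set s : LaurentRing k := single (1, 0) 1 - 1 with hs
  set t : LaurentRing k := single (0, 1) 1 - 1 with ht
  have taylor : (single ((a : ℤ), (b : ℤ)) 1 : LaurentRing k) =
      ∑ i ∈ Finset.range (a + 1), ∑ j ∈ Finset.range (b + 1),
        (a.choose i * b.choose j) • (s ^ i * t ^ j) := by
    have h : (single ((a : ℤ), (b : ℤ)) 1 : LaurentRing k) = (s + 1) ^ a * (t + 1) ^ b := by
      simp [hs, ht, single_pow, single_mul_single]
    rw [h, add_pow, add_pow, Finset.sum_mul_sum]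
    refine Finset.sum_congr rfl fun i _ => Finset.sum_congr rfl fun j _ => ?_
    rw [nsmul_eq_mul]
    push_cast
    ring
  rw [taylor, map_sum]
  refine Submodule.sum_mem _ fun i _ => ?_
  rw [map_sum]
  refine Submodule.sum_mem _ fun j _ => ?_
  rw [map_nsmul]
  refine nsmul_mem ?_ _
  by_cases hij : i + j < m
  · refine Submodule.subset_span ⟨⟨i, j⟩, ?_, rfl⟩
    simp only [Finset.coe_sigma, Set.mem_sigma_iff, Finset.coe_range, Set.mem_Iio]
    omega
  · have hmem : s ^ i * t ^ j ∈ idealE k ^ (i + j) := by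
      rw [pow_add]
      exact Ideal.mul_mem_mul (Ideal.pow_mem_pow (Ideal.subset_span (.inl rfl)) i)
        (Ideal.pow_mem_pow (Ideal.subset_span (.inr rfl)) j)
    rw [Ideal.Quotient.eq_zero_iff_mem.2 (Ideal.pow_le_pow_right (not_lt.1 hij) hmem)]
    exact zero_mem _

theorem card_le_of_linearIndepOn_of_mem_span_jetMonomials {ι : Type*} {m : ℕ} {T : Finset ι}
    {jet : ι → LaurentRing k ⧸ idealE k ^ m} (hjet : LinearIndepOn k jet T)
    (hspan : ∀ u ∈ T, jet u ∈ Submodule.span k (jetMonomials k m)) :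
    T.card ≤ ∑ i ∈ Finset.range m, (m - i) := by
  have hfin : (jetMonomials k m).Finite := Set.Finite.image _ (Finset.finite_toSet _)
  have := hfin.fintype
  have hle := linearIndependent_le_span_aux' _ hjet (jetMonomials k m) <| by
    rintro _ ⟨u, rfl⟩
    exact hspan u u.2
  have hcard : Fintype.card (jetMonomials k m) ≤ ∑ i ∈ Finset.range m, (m - i) := by
    rw [← Nat.card_eq_fintype_card, Nat.card_coe_set_eq, jetMonomials]
    refine (Set.ncard_image_le (Finset.finite_toSet _)).trans ?_
    rw [Set.ncard_coe_finset, Finset.card_sigma]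
    simp
  simp only [Finset.coe_sort_coe, Fintype.card_coe] at hle
  exact hle.trans hcard

/-- Vanishing to order `m` imposes at most `m + (m - 1) + ⋯ + 1` linear conditions. -/
theorem exists_ne_zero_mem_idealE_pow {m : ℕ} {T : Finset (ℤ × ℤ)}
    (hT : ∑ i ∈ Finset.range m, (m - i) < T.card) :
    ∃ f : LaurentRing k, f ≠ 0 ∧ f ∈ idealE k ^ m ∧ f.coeff.support ⊆ T := by
  classical
  obtain ⟨w, hw⟩ := T.bddBelow
  let jet (u : ℤ × ℤ) := Ideal.Quotient.mk (idealE k ^ m) (single (u - w) 1)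
  have jet_mem (u) (hu : u ∈ T) : jet u ∈ Submodule.span k (jetMonomials k m) := by
    obtain ⟨a, ha⟩ := Int.eq_ofNat_of_zero_le (sub_nonneg.2 (hw hu).1)
    obtain ⟨b, hb⟩ := Int.eq_ofNat_of_zero_le (sub_nonneg.2 (hw hu).2)
    have huw : u - w = ((a : ℤ), (b : ℤ)) := Prod.ext ha hb
    simpa only [jet, huw] using mk_single_mem_span_jetMonomials m a b
  have not_indep : ¬ LinearIndepOn k jet T := fun h =>
    (card_le_of_linearIndepOn_of_mem_span_jetMonomials h jet_mem).not_gt hT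
  rw [linearIndepOn_finset_iff] at not_indep
  push Not at not_indep
  obtain ⟨c, hsum, u, hu, hcu⟩ := not_indep
  have coeff_eq (v) : (∑ u ∈ T, single u (c u) : LaurentRing k).coeff v =
      if v ∈ T then c v else 0 := by
    simp [coeff_sum, Finsupp.finsetSum_apply, Finsupp.single_apply]
  refine ⟨∑ u ∈ T, single u (c u), fun h => hcu ?_, ?_, fun v hv => ?_⟩
  · have := coeff_eq u
    rwa [h, coeff_zero, Finsupp.zero_apply, if_pos hu, eq_comm] at this
  · rw [← Ideal.unit_mul_mem_iff_mem _ (isUnit_single (-w) one_ne_zero), Finset.mul_sum,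
      ← Ideal.Quotient.eq_zero_iff_mem, map_sum, ← hsum]
    refine Finset.sum_congr rfl fun u _ => ?_
    have h : (single (-w) 1 * single u (c u) : LaurentRing k) = c u • single (u - w) 1 := by
      simp [single_mul_single, smul_single, sub_eq_neg_add]
    rw [h]
    rfl
  · by_contra hvT
    exact Finsupp.mem_support_iff.1 hv (by rw [coeff_eq, if_neg hvT])

end DimensionCount

section Width

theorem single_sub_one_dvd_of_mapDomain_eq_zero {R A : Type*} [CommRing R] [AddCommGroup A]
    {v : A} {π : A → A} (hπ : ∀ u, ∃ j : ℤ, u - π u = j • v) {f : AddMonoidAlgebra R A}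
    (hf : mapDomain π f = 0) : single v 1 - 1 ∣ f := by
  rw [← Ideal.mem_span_singleton, ← Ideal.Quotient.eq_zero_iff_mem]
  set q := Ideal.Quotient.mk (Ideal.span {(single v 1 - 1 : AddMonoidAlgebra R A)})
  let χ : Multiplicative A →* _ := q.toMonoidHom.comp (of R A)
  have hχ : χ (.ofAdd v) = 1 := by
    rw [← sub_eq_zero, ← map_one q]
    exact (map_sub q _ _).symm.trans
      (Ideal.Quotient.eq_zero_iff_mem.2 (Ideal.mem_span_singleton_self _))
  have single_eq (u : A) (c : R) : q (single u c) = q (single (π u) c) := by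
    obtain ⟨j, hj⟩ := hπ u
    have hker : Multiplicative.ofAdd (u - π u) ∈ χ.ker := by
      rw [hj, ofAdd_zsmul]
      exact zpow_mem hχ j
    have hu : (single u c : AddMonoidAlgebra R A) = single (u - π u) 1 * single (π u) c := by
      rw [single_mul_single, sub_add_cancel, one_mul]
    rw [hu, map_mul]
    exact (congrArg (· * q (single (π u) c)) hker).trans (one_mul _)
  have mk_eq (f : AddMonoidAlgebra R A) : q f = q (mapDomain π f) := by
    induction f using AddMonoidAlgebra.induction_linear with
    | zero => simp
    | add f g hf hg => rw [mapDomain_add, map_add, map_add, hf, hg]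
    | single u c => rw [mapDomain_single, single_eq]
  rw [mk_eq, hf, map_zero]

theorem HasVanishingMoments.mapDomain_eq_zero {R A : Type*} [CommRing R] [IsDomain R] [CharZero R]
    [AddCommMonoid A] {m : ℕ} {f : AddMonoidAlgebra R A} (hf : HasVanishingMoments m f)
    (φ : A →+ ℤ) (hwidth : ∀ u ∈ f.coeff.support, ∀ v ∈ f.coeff.support, φ v - φ u < m) :
    AddMonoidAlgebra.mapDomain φ f = 0 := by
  classical
  by_contra hne
  have hsupp : ∀ l ∈ (AddMonoidAlgebra.mapDomain φ f).coeff.support,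
      ∃ u ∈ f.coeff.support, φ u = l := fun l hl =>
    Finset.mem_image.1 (Finsupp.mapDomain_support hl)
  obtain ⟨l, hl⟩ : (AddMonoidAlgebra.mapDomain φ f).coeff.support.Nonempty :=
    Finsupp.support_nonempty_iff.2 fun h => hne (coeff_eq_zero.1 h)
  obtain ⟨u₀, hu₀, hmin⟩ := f.coeff.support.exists_min_image φ <| by
    obtain ⟨u, hu, -⟩ := hsupp l hl
    exact ⟨u, hu⟩
  have mem_Ico : ∀ l ∈ (AddMonoidAlgebra.mapDomain φ f).coeff.support,
      l ∈ Finset.Ico (φ u₀) (φ u₀ + m) := by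
    intro l hl
    obtain ⟨u, hu, rfl⟩ := hsupp l hl
    exact Finset.mem_Ico.2 ⟨hmin u hu, by linarith [hwidth u₀ hu₀ u hu]⟩
  refine Finsupp.mem_support_iff.1 hl <| (hf.mapDomain φ).coeff_eq_zero_of_isolated
    (s := (Finset.Ico (φ u₀) (φ u₀ + m)).erase l) ?_ (fun _ => .id ℤ) id
    (fun i hi => (Finset.ne_of_mem_erase hi).symm)
    fun v hv hvl => ⟨v, Finset.mem_erase.2 ⟨hvl, mem_Ico v hv⟩, rfl⟩
  have hcard := Finset.card_erase_add_one (mem_Ico l hl)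
  rw [Int.card_Ico] at hcard
  omega

variable {k : Type*} [Field k]

theorem eq_zero_of_single_sub_one_mem_idealE_sq [CharZero k] {v : ℤ × ℤ}
    (hv : (single v 1 - 1 : LaurentRing k) ∈ idealE k ^ 2) : v = 0 := by
  have hzero (φ : ℤ × ℤ →+ ℤ) : φ v = 0 := by
    have h := hasVanishingMoments_of_mem_idealE_pow hv _
      (sub_mul_mem_degreeLT φ 0 one_mem_degreeLT)
    simpa [one_def, moment_single] using h
  exact Prod.ext (hzero (.fst ℤ ℤ)) (hzero (.snd ℤ ℤ))

theorem not_isUnit_single_sub_one (v : ℤ × ℤ) : ¬ IsUnit (single v 1 - 1 : LaurentRing k) := by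
  intro hunit
  obtain ⟨w, c, hc, h⟩ := exists_eq_single_of_isUnit hunit
  have hmoment := congrArg (moment fun _ => (1 : k)) h
  rw [map_sub, one_def, moment_single, moment_single, moment_single, sub_self, mul_one] at hmoment
  exact hc hmoment.symm

theorem exists_width_ge [CharZero k] {f : LaurentRing k} {m : ℕ} (hm : 2 ≤ m)
    (hirr : Irreducible f) (hf : f ∈ idealE k ^ m) {a b : ℤ} (hab : IsCoprime a b) :
    ∃ u ∈ f.coeff.support, ∃ v ∈ f.coeff.support,
      m ≤ (a * v.1 + b * v.2) - (a * u.1 + b * u.2) := by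
  by_contra! hnarrow
  let φ : ℤ × ℤ →+ ℤ := a • .fst ℤ ℤ + b • .snd ℤ ℤ
  have φ_apply (u) : φ u = a * u.1 + b * u.2 := by simp [φ]
  have hφf : mapDomain φ f = 0 :=
    (hasVanishingMoments_of_mem_idealE_pow hf).mapDomain_eq_zero φ (by simpa only [φ_apply])
  obtain ⟨s, t, hst⟩ := hab
  have hdvd : (single (-b, a) 1 - 1 : LaurentRing k) ∣ f := by
    refine single_sub_one_dvd_of_mapDomain_eq_zero (π := fun u => φ u • (s, t))
      (fun u => ⟨s * u.2 - t * u.1, ?_⟩) ?_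
    · ext <;> simp only [φ_apply, Prod.fst_sub, Prod.snd_sub, Prod.smul_mk, smul_eq_mul]
      · linear_combination (-u.1) * hst
      · linear_combination (-u.2) * hst
    · have hcomp : mapDomain (fun u => φ u • (s, t)) f =
          mapDomain (fun l : ℤ => l • (s, t)) (mapDomain φ f) := by
        ext : 1
        exact Finsupp.mapDomain_comp (f := φ) (g := fun l : ℤ => l • (s, t))
      rw [hcomp, hφf, mapDomain_zero]
  obtain ⟨g, rfl⟩ := hdvd
  have hg := (hirr.isUnit_or_isUnit rfl).resolve_left (not_isUnit_single_sub_one _)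
  have hv := eq_zero_of_single_sub_one_mem_idealE_sq
    (Ideal.pow_le_pow_right hm ((Ideal.mul_unit_mem_iff_mem _ hg).1 hf))
  rw [Prod.ext_iff] at hv
  simp only [Prod.fst_zero, Prod.snd_zero, neg_eq_zero] at hv
  simp [hv.1, hv.2] at hst

end Width

section Triangles

/-- Numerical conditions on the triangle with vertices `(0, 0)`, `(m, n)` and `(m - n / K, 0)` which
ensure that its columns have `1, 1, 2, …, m` lattice points, in some order. The last two fields say
that its area lies between `(m² - 1) / 2` and `m² / 2`. -/
structure IsAdmissible (m n K : ℤ) : Prop where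
  m_pos : 0 < m
  n_pos : 0 < n
  n_lt : n < K * m
  coprime : IsCoprime m n
  le_area : K * (m ^ 2 - 1) ≤ n * (K * m - n)
  area_lt : n * (K * m - n) < K * m ^ 2

/-- The lattice points of the triangle with vertices `(0, 0)`, `(m, n)` and `(m - n / K, 0)`. -/
def latticeTriangle (m n K : ℤ) : Set (ℤ × ℤ) :=
  {u | 0 ≤ u.2 ∧ n + K * (u.1 - m) ≤ u.2 ∧ m * u.2 ≤ n * u.1}

/-- The ordinates of the points of `latticeTriangle m n K` with abscissa `i`. -/
noncomputable def column (m n K i : ℤ) : Finset ℤ :=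
  Finset.Icc (max 0 (n + K * (i - m))) (i * n / m)

variable {m n K : ℤ}

theorem mem_column (hm : 0 < m) {i j : ℤ} :
    j ∈ column m n K i ↔ (i, j) ∈ latticeTriangle m n K := by
  rw [column, Finset.mem_Icc, max_le_iff, Int.le_ediv_iff_mul_le hm, mul_comm j, mul_comm i,
    and_assoc]
  rfl

theorem lt_card_column_iff (hm : 0 < m) {i : ℤ} {s : ℕ} :
    s < (column m n K i).card ↔ s * m ≤ i * n ∧ s * m ≤ (m - i) * (K * m - n) := by
  have hcard : s < (column m n K i).card ↔
      (s : ℤ) ≤ i * n / m ∧ s + (n + K * (i - m)) ≤ i * n / m := by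
    rw [column, Int.card_Icc]
    omega
  rw [hcard, Int.le_ediv_iff_mul_le hm, Int.le_ediv_iff_mul_le hm]
  refine and_congr_right fun _ => ?_
  constructor <;> intro <;> linarith

namespace IsAdmissible

theorem fst_nonneg (h : IsAdmissible m n K) {u : ℤ × ℤ} (hu : u ∈ latticeTriangle m n K) :
    0 ≤ u.1 :=
  nonneg_of_mul_nonneg_right ((mul_nonneg h.m_pos.le hu.1).trans hu.2.2) h.n_pos

theorem fst_le (h : IsAdmissible m n K) {u : ℤ × ℤ} (hu : u ∈ latticeTriangle m n K) :
    u.1 ≤ m := by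
  have hprod : 0 ≤ (K * m - n) * (m - u.1) := by
    linarith [mul_le_mul_of_nonneg_left hu.2.1 h.m_pos.le, hu.2.2]
  exact sub_nonneg.1 (nonneg_of_mul_nonneg_right hprod (sub_pos.2 h.n_lt))

theorem eq_zero_of_fst_eq_zero (h : IsAdmissible m n K) {u : ℤ × ℤ}
    (hu : u ∈ latticeTriangle m n K) (hu₁ : u.1 = 0) : u = 0 := by
  refine Prod.ext hu₁ (le_antisymm ?_ hu.1)
  have habove := hu.2.2
  rw [hu₁, mul_zero] at habove
  exact nonpos_of_mul_nonpos_right habove h.m_pos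

theorem eq_corner_of_fst_eq (h : IsAdmissible m n K) {u : ℤ × ℤ}
    (hu : u ∈ latticeTriangle m n K) (hu₁ : u.1 = m) : u = (m, n) := by
  obtain ⟨-, hright, habove⟩ := hu
  rw [hu₁] at hright habove
  refine Prod.ext hu₁ (le_antisymm ?_ (by linarith))
  exact le_of_mul_le_mul_left (by linarith) h.m_pos

theorem hasPrimitiveUpperEdge (h : IsAdmissible m n K) {S : Set (ℤ × ℤ)}
    (hS : S ⊆ latticeTriangle m n K) (hzero : (0, 0) ∈ S) (hcorner : (m, n) ∈ S) :
    HasPrimitiveUpperEdge S m n where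
  pos := h.m_pos
  coprime := h.coprime
  zero_mem := hzero
  corner_mem := hcorner
  fst_nonneg _ hu := h.fst_nonneg (hS hu)
  fst_le _ hu := h.fst_le (hS hu)
  below _ hu := (hS hu).2.2
  snd_eq_zero _ hu hu₁ := congrArg Prod.snd (h.eq_zero_of_fst_eq_zero (hS hu) hu₁)

theorem ediv_add_ediv (h : IsAdmissible m n K) {s : ℤ} (hs : 0 < s) (hsm : s < m) :
    (s * m - 1) / n + (s * m - 1) / (K * m - n) = s - 1 := by
  have hn := h.n_pos
  have hn' : 0 < K * m - n := sub_pos.2 h.n_lt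
  have hP : 0 < n * (K * m - n) := mul_pos hn hn'
  set a := (s * m - 1) / n
  set b := (s * m - 1) / (K * m - n)
  have a_le : a * n ≤ s * m - 1 := Int.ediv_mul_le _ hn.ne'
  have b_le : b * (K * m - n) ≤ s * m - 1 := Int.ediv_mul_le _ hn'.ne'
  have le_a : s * m ≤ (a + 1) * n := by linarith [Int.lt_ediv_add_one_mul_self (s * m - 1) hn]
  have le_b : s * m ≤ (b + 1) * (K * m - n) := by
    linarith [Int.lt_ediv_add_one_mul_self (s * m - 1) hn']
  have hK : 0 < K := pos_of_mul_pos_left (hn.trans h.n_lt) h.m_pos.le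
  have upper : (n * (K * m - n)) * (a + b) < (n * (K * m - n)) * s := by
    calc (n * (K * m - n)) * (a + b)
        = a * n * (K * m - n) + b * (K * m - n) * n := by ring
      _ ≤ (s * m - 1) * (K * m - n) + (s * m - 1) * n := by gcongr
      _ = s * (K * (m ^ 2 - 1)) - K * (m - s) := by ring
      _ < s * (K * (m ^ 2 - 1)) := sub_lt_self _ (mul_pos hK (sub_pos.2 hsm))
      _ ≤ s * (n * (K * m - n)) := mul_le_mul_of_nonneg_left h.le_area hs.le
      _ = (n * (K * m - n)) * s := mul_comm _ _
  have lower : (n * (K * m - n)) * s < (n * (K * m - n)) * (a + b + 2) := by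
    calc (n * (K * m - n)) * s
        < K * m ^ 2 * s := mul_lt_mul_of_pos_right h.area_lt hs
      _ = s * m * (K * m - n) + s * m * n := by ring
      _ ≤ (a + 1) * n * (K * m - n) + (b + 1) * (K * m - n) * n := by gcongr
      _ = (n * (K * m - n)) * (a + b + 2) := by ring
  have := lt_of_mul_lt_mul_left upper hP.le
  have := lt_of_mul_lt_mul_left lower hP.le
  omega

theorem card_column_pos (h : IsAdmissible m n K) {i : ℤ} (hi : 0 ≤ i) (him : i ≤ m) :
    0 < (column m n K i).card := by
  rw [lt_card_column_iff h.m_pos, Nat.cast_zero, zero_mul]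
  exact ⟨mul_nonneg hi h.n_pos.le, mul_nonneg (sub_nonneg.2 him) (sub_nonneg.2 h.n_lt.le)⟩

theorem card_column_le {m : ℕ} (h : IsAdmissible m n K) (i : ℤ) : (column m n K i).card ≤ m := by
  by_contra! hlt
  obtain ⟨hleft, hright⟩ := (lt_card_column_iff h.m_pos).1 hlt
  have hcontra : (m : ℤ) * (K * m ^ 2) < m * (K * m ^ 2) := by
    calc (m : ℤ) * (K * m ^ 2) = m * m * (K * m - n) + m * m * n := by ring
      _ ≤ i * n * (K * m - n) + (m - i) * (K * m - n) * n := by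
        gcongr
        · exact sub_nonneg.2 h.n_lt.le
        · exact h.n_pos.le
      _ = m * (n * (K * m - n)) := by ring
      _ < m * (K * m ^ 2) := mul_lt_mul_of_pos_left h.area_lt h.m_pos
  exact hcontra.false

theorem card_columns {m : ℕ} (h : IsAdmissible m n K) {s : ℕ} (hsm : s < m) {e : ℤ}
    (he : e = 0 ∨ e = m) :
    {i ∈ (Finset.Icc 0 (m : ℤ)).erase e | s < (column m n K i).card}.card = m - s := by
  have hm := h.m_pos
  rcases Nat.eq_zero_or_pos s with rfl | hs
  · have hall : ∀ i ∈ (Finset.Icc 0 (m : ℤ)).erase e, 0 < (column m n K i).card := fun i hi => by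
      obtain ⟨hi₀, him⟩ := Finset.mem_Icc.1 (Finset.mem_of_mem_erase hi)
      exact h.card_column_pos hi₀ him
    rw [Finset.filter_true_of_mem hall, Finset.card_erase_of_mem, Int.card_Icc]
    · omega
    · rw [Finset.mem_Icc]
      omega
  · have hn' : 0 < K * m - n := sub_pos.2 h.n_lt
    have lt_iff (i : ℤ) : s < (column m n K i).card ↔
        (s * m - 1) / n < i ∧ (s * m - 1) / (K * m - n) < m - i := by
      rw [lt_card_column_iff hm, Int.ediv_lt_iff_lt_mul h.n_pos, Int.ediv_lt_iff_lt_mul hn',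
        Int.sub_one_lt_iff, Int.sub_one_lt_iff]
    have hnum : 0 ≤ (s : ℤ) * m - 1 := by
      linarith [mul_pos (Int.natCast_pos.2 hs) hm]
    have h₁ := Int.ediv_nonneg hnum h.n_pos.le
    have h₂ := Int.ediv_nonneg hnum hn'.le
    have hsum := h.ediv_add_ediv (Int.natCast_pos.2 hs) (Int.ofNat_lt.2 hsm)
    have heq : {i ∈ (Finset.Icc 0 (m : ℤ)).erase e | s < (column m n K i).card} =
        Finset.Ioo ((s * m - 1) / n) (m - (s * m - 1) / (K * m - n)) := by
      ext i
      rw [Finset.mem_filter, lt_iff, Finset.mem_erase, Finset.mem_Icc, Finset.mem_Ioo]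
      omega
    rw [heq, Int.card_Ioo]
    omega

theorem exists_finset {m : ℕ} (h : IsAdmissible m n K) :
    ∃ T : Finset (ℤ × ℤ), (T : Set (ℤ × ℤ)) ⊆ latticeTriangle m n K ∧
      ∑ s ∈ Finset.range m, (m - s) < T.card := by
  refine ⟨((Finset.Icc 0 (m : ℤ)).sigma (column m n K)).map
    (Equiv.sigmaEquivProd ℤ ℤ).toEmbedding, ?_, ?_⟩
  · intro u hu
    obtain ⟨x, hx, rfl⟩ := Finset.mem_map.1 hu
    exact (mem_column h.m_pos).1 (Finset.mem_sigma.1 hx).2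
  · rw [Finset.card_map, Finset.card_sigma,
      ← Finset.add_sum_erase _ _ (Finset.left_mem_Icc.2 (Int.natCast_nonneg m))]
    refine lt_add_of_pos_of_le (h.card_column_pos le_rfl (Int.natCast_nonneg m)) ?_
    calc ∑ s ∈ Finset.range m, (m - s)
        = ∑ s ∈ Finset.range m,
            {i ∈ (Finset.Icc 0 (m : ℤ)).erase 0 | s < (column m n K i).card}.card :=
          Finset.sum_congr rfl fun s hs =>
            (h.card_columns (Finset.mem_range.1 hs) (Or.inl rfl)).symm
      _ = ∑ i ∈ (Finset.Icc 0 (m : ℤ)).erase 0,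
            {s ∈ Finset.range m | s < (column m n K i).card}.card :=
          Finset.sum_card_bipartiteAbove_eq_sum_card_bipartiteBelow _
      _ ≤ ∑ i ∈ (Finset.Icc 0 (m : ℤ)).erase 0, (column m n K i).card :=
          Finset.sum_le_sum fun i _ => by
            refine (Finset.card_le_card fun s hs => ?_).trans (Finset.card_range _).le
            exact Finset.mem_range.2 (Finset.mem_filter.1 hs).2

variable {k : Type*} [Field k] [CharZero k]

/-- Take an exponent `u` in a column with the fewest points among those that `f` meets: the other
columns with at least as many points, and the rows through the other points of the column of `u`,
are `m - 1` lines covering all exponents of `f` but `u`. -/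
theorem eq_zero_of_missing_column {m : ℕ} (h : IsAdmissible m n K) {f : LaurentRing k}
    (hf : f ∈ idealE k ^ m) (hsupp : (f.coeff.support : Set (ℤ × ℤ)) ⊆ latticeTriangle m n K)
    {e : ℤ} (he : e = 0 ∨ e = m) (hmiss : ∀ u ∈ f.coeff.support, u.1 ≠ e) : f = 0 := by
  by_contra hne
  obtain ⟨u, hu, hmin⟩ := f.coeff.support.exists_min_image (fun v => (column m n K v.1).card)
    (by simpa using hne)
  have mem_column_fst (v) (hv : v ∈ f.coeff.support) : v.2 ∈ column m n K v.1 :=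
    (mem_column h.m_pos).2 (hsupp hv)
  have hpos : 0 < (column m n K u.1).card := Finset.card_pos.2 ⟨_, mem_column_fst u hu⟩
  have hle := h.card_column_le u.1
  let large := {i ∈ (Finset.Icc 0 (m : ℤ)).erase e |
    (column m n K u.1).card - 1 < (column m n K i).card}
  have mem_large (v) (hv : v ∈ f.coeff.support) : v.1 ∈ large := by
    have := hmin v hv
    refine Finset.mem_filter.2 ⟨Finset.mem_erase.2 ⟨hmiss v hv, Finset.mem_Icc.2 ⟨?_, ?_⟩⟩, ?_⟩
    · exact h.fst_nonneg (hsupp hv)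
    · exact h.fst_le (hsupp hv)
    · omega
  let lines : Finset (ℤ ⊕ ℤ) := (large.erase u.1).disjSum ((column m n K u.1).erase u.2)
  have hcard : lines.card < m := by
    have hlarge : large.card = m - ((column m n K u.1).card - 1) :=
      h.card_columns (by omega) he
    rw [Finset.card_disjSum, Finset.card_erase_of_mem (mem_large u hu),
      Finset.card_erase_of_mem (mem_column_fst u hu), hlarge]
    omega
  refine Finsupp.mem_support_iff.1 hu <|
    (hasVanishingMoments_of_mem_idealE_pow hf).coeff_eq_zero_of_isolated hcard
      (Sum.elim (fun _ => .fst ℤ ℤ) fun _ => .snd ℤ ℤ) (Sum.elim id id) ?_ fun v hv hvu => ?_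
  · rintro (i | j) hij
    · exact (Finset.ne_of_mem_erase (Finset.inl_mem_disjSum.1 hij)).symm
    · exact (Finset.ne_of_mem_erase (Finset.inr_mem_disjSum.1 hij)).symm
  · by_cases hcol : v.1 = u.1
    · refine ⟨.inr v.2, Finset.inr_mem_disjSum.2 (Finset.mem_erase.2 ⟨?_, ?_⟩), rfl⟩
      · exact fun hrow => hvu (Prod.ext hcol hrow)
      · exact hcol ▸ mem_column_fst v hv
    · exact ⟨.inl v.1, Finset.inl_mem_disjSum.2 (Finset.mem_erase.2 ⟨hcol, mem_large v hv⟩), rfl⟩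

theorem zero_mem_support {m : ℕ} (h : IsAdmissible m n K) {f : LaurentRing k} (hf₀ : f ≠ 0)
    (hf : f ∈ idealE k ^ m) (hsupp : (f.coeff.support : Set (ℤ × ℤ)) ⊆ latticeTriangle m n K) :
    (0, 0) ∈ f.coeff.support := by
  by_contra hzero
  refine hf₀ (h.eq_zero_of_missing_column hf hsupp (Or.inl rfl) fun u hu hu₁ => hzero ?_)
  rwa [h.eq_zero_of_fst_eq_zero (hsupp hu) hu₁] at hu

theorem corner_mem_support {m : ℕ} (h : IsAdmissible m n K) {f : LaurentRing k} (hf₀ : f ≠ 0)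
    (hf : f ∈ idealE k ^ m) (hsupp : (f.coeff.support : Set (ℤ × ℤ)) ⊆ latticeTriangle m n K) :
    ((m : ℤ), n) ∈ f.coeff.support := by
  by_contra hcorner
  refine hf₀ (h.eq_zero_of_missing_column hf hsupp (Or.inr rfl) fun u hu hu₁ => hcorner ?_)
  rwa [h.eq_corner_of_fst_eq (hsupp hu) hu₁] at hu

end IsAdmissible

section

variable {k : Type*} [Field k] [CharZero k]

theorem HasPrimitiveUpperEdge.notMem_idealE_pow {m : ℕ} {f : LaurentRing k}
    (hf : HasPrimitiveUpperEdge (f.coeff.support : Set (ℤ × ℤ)) m n) :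
    f ∉ idealE k ^ (m + 1) := by
  intro hmem
  refine Finsupp.mem_support_iff.1 hf.zero_mem <|
    (hasVanishingMoments_of_mem_idealE_pow hmem).coeff_eq_zero_of_isolated
      (s := Finset.Icc 1 (m : ℤ)) (by simp) (fun _ => .fst ℤ ℤ) id
      (fun i hi => (zero_lt_one.trans_le (Finset.mem_Icc.1 hi).1).ne) fun u hu hu₀ => ?_
  have hu₁ : u.1 ≠ 0 := fun h => hu₀ (Prod.ext h (hf.snd_eq_zero u hu h))
  have hnonneg := hf.fst_nonneg u hu
  exact ⟨u.1, Finset.mem_Icc.2 ⟨by omega, hf.fst_le u hu⟩, rfl⟩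

theorem IsAdmissible.exists_irreducible_vanishesToOrder {m : ℕ} (h : IsAdmissible m n K) :
    ∃ f : LaurentRing k, Irreducible f ∧ VanishesToOrder f m ∧
      (f.coeff.support : Set (ℤ × ℤ)) ⊆ latticeTriangle m n K := by
  obtain ⟨T, hT, hcard⟩ := h.exists_finset
  obtain ⟨f, hf₀, hf, hfT⟩ := exists_ne_zero_mem_idealE_pow (k := k) hcard
  have hsupp : (f.coeff.support : Set (ℤ × ℤ)) ⊆ latticeTriangle m n K :=
    (Finset.coe_subset.2 hfT).trans hT
  have hedge := h.hasPrimitiveUpperEdge hsupp (h.zero_mem_support hf₀ hf hsupp)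
    (h.corner_mem_support hf₀ hf hsupp)
  exact ⟨f, hedge.irreducible, ⟨hf, hedge.notMem_idealE_pow⟩, hsupp⟩

end

end Triangles

section Regions

theorem add_smul_mem_convexHull_triple {E : Type*} [AddCommGroup E] [Module ℝ E] (x y z : E)
    {a b c : ℝ} (ha : 0 ≤ a) (hb : 0 ≤ b) (hc : 0 ≤ c) (habc : a + b + c = 1) :
    a • x + b • y + c • z ∈ convexHull ℝ {x, y, z} := by
  have h := (convex_convexHull ℝ {x, y, z}).sum_mem (t := Finset.univ) (w := ![a, b, c])
    (z := ![x, y, z]) (by simp [Fin.forall_fin_succ, ha, hb, hc])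
    (by simpa [Fin.sum_univ_three] using habc)
    fun i _ => subset_convexHull ℝ _ (by fin_cases i <;> simp)
  simpa [Fin.sum_univ_three] using h

theorem convexHull_triangle_eq {m n K : ℝ} (hn : 0 < n) (hK : 0 < K) (hnK : n < K * m) :
    convexHull ℝ {((0 : ℝ), (0 : ℝ)), (m, n), (m - n / K, 0)} =
      {z | 0 ≤ z.2 ∧ n + K * (z.1 - m) ≤ z.2 ∧ m * z.2 ≤ n * z.1} := by
  have hgap : 0 < K * m - n := sub_pos.2 hnK
  have hbase : 0 < m - n / K := by rw [sub_pos, div_lt_iff₀ hK]; linarith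
  refine Set.Subset.antisymm (convexHull_min ?_ ?_) fun z ⟨h₁, h₂, h₃⟩ => ?_
  · have hdiv : K * (n / K) = n := by field_simp
    rintro z (rfl | rfl | rfl) <;>
      simp only [Set.mem_ofPred_eq, mul_zero, sub_self, zero_sub, add_zero, le_refl,
        true_and, and_true]
    · linarith
    · exact ⟨hn.le, (mul_comm m n).le⟩
    · exact ⟨by linarith, by positivity⟩
  · rintro x ⟨hx₁, hx₂, hx₃⟩ y ⟨hy₁, hy₂, hy₃⟩ a b ha hb hab
    obtain rfl : b = 1 - a := by linarith
    simp only [Set.mem_ofPred_eq, Prod.fst_add, Prod.snd_add, Prod.smul_fst, Prod.smul_snd,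
      smul_eq_mul]
    refine ⟨by positivity, ?_, ?_⟩
    · linarith [mul_le_mul_of_nonneg_left hx₂ ha, mul_le_mul_of_nonneg_left hy₂ hb]
    · linarith [mul_le_mul_of_nonneg_left hx₃ ha, mul_le_mul_of_nonneg_left hy₃ hb]
  · have hz : z = ((z.2 - (n + K * (z.1 - m))) / (K * m - n)) • ((0 : ℝ), (0 : ℝ)) +
        (z.2 / n) • (m, n) +
        (K * (n * z.1 - m * z.2) / (n * (K * m - n))) • (m - n / K, (0 : ℝ)) := by
      ext <;> simp only [Prod.fst_add, Prod.snd_add, Prod.smul_mk, smul_eq_mul]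
      · field_simp
        ring
      · field_simp
        ring
    rw [hz]
    refine add_smul_mem_convexHull_triple _ _ _ (div_nonneg (sub_nonneg.2 h₂) hgap.le)
      (div_nonneg h₁ hn.le)
      (div_nonneg (mul_nonneg hK.le (sub_nonneg.2 h₃)) (mul_pos hn hgap).le) ?_
    field_simp
    ring

theorem newtonPolygon_subset_region_iff {k : Type*} [Field k] (f : LaurentRing k)
    (D : PlaneTriangle) :
    newtonPolygon f ⊆ D.region ↔
      ∀ u ∈ f.coeff.support, ((u.1 : ℝ), (u.2 : ℝ)) ∈ D.region :=
  (convex_convexHull ℝ _).convexHull_subset_iff.trans Set.image_subset_iff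

theorem IsAdmissible.newtonPolygon_subset_iff {k : Type*} [Field k] {m n K : ℤ}
    (h : IsAdmissible m n K) {f : LaurentRing k} {D : PlaneTriangle}
    (hp : D.p = (0, 0)) (hq : D.q = ((m : ℝ), (n : ℝ)))
    (hr : D.r = ((m : ℝ) - (n : ℝ) / K, 0)) :
    newtonPolygon f ⊆ D.region ↔
      (f.coeff.support : Set (ℤ × ℤ)) ⊆ latticeTriangle m n K := by
  rw [newtonPolygon_subset_region_iff]
  refine forall₂_congr fun u _ => ?_
  have hK : 0 < K := pos_of_mul_pos_left (h.n_pos.trans h.n_lt) h.m_pos.le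
  rw [PlaneTriangle.region, hp, hq, hr, convexHull_triangle_eq (Int.cast_pos.2 h.n_pos)
    (Int.cast_pos.2 hK) (by exact_mod_cast h.n_lt)]
  simp only [latticeTriangle, Set.mem_ofPred_eq]
  norm_cast

end Regions

section Existence

variable {M N K : ℕ}

namespace IsSolution

theorem natCast_eq (h : IsSolution M N K) : ((M : ℤ) + N) ^ 2 = K * M * N + 1 := by
  exact_mod_cast h.2

theorem isAdmissible_IT (h : IsSolution M N K) (hM : 0 < M) (hN : 0 < N) :
    IsAdmissible ((M + N : ℕ) : ℤ) (K * N) K := by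
  have hK : (0 : ℤ) < K := Int.natCast_pos.2 (by linarith [h.1])
  have harea : K * (N : ℤ) * (K * (M + N : ℕ) - K * N) = K * ((M + N : ℕ) ^ 2 - 1) := by
    push_cast
    linear_combination (-(K : ℤ)) * h.natCast_eq
  exact
    { m_pos := by omega
      n_pos := by positivity
      n_lt := mul_lt_mul_of_pos_left (by omega) hK
      coprime := ⟨M + N, -M, by push_cast; linear_combination h.natCast_eq⟩
      le_area := harea.ge
      area_lt := harea.trans_lt (mul_lt_mul_of_pos_left (sub_one_lt _) hK) }

theorem isAdmissible_RT (h : IsSolution M N K) (hM : 0 < M) :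
    IsAdmissible M ((M : ℤ) + N) K := by
  have hK : (3 : ℤ) ≤ K := by exact_mod_cast h.1
  have hM' : (0 : ℤ) < M := Int.natCast_pos.2 hM
  have harea : ((M : ℤ) + N) * (K * M - (M + N)) = K * M ^ 2 - 1 := by
    linear_combination -h.natCast_eq
  have harea_pos : 0 < ((M : ℤ) + N) * (K * M - (M + N)) := by
    rw [harea]
    nlinarith
  exact
    { m_pos := hM'
      n_pos := by positivity
      n_lt := sub_pos.1 (pos_of_mul_pos_right harea_pos (by positivity))
      coprime := ⟨-(K * N), M + N, by linear_combination h.natCast_eq⟩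
      le_area := by rw [harea]; linarith
      area_lt := by rw [harea]; exact sub_one_lt _ }

theorem area_IT (h : IsSolution M N K) : (IT M N K).area = (((M : ℝ) + N) ^ 2 - 1) / 2 := by
  have hsol : ((M : ℝ) + N) ^ 2 = K * M * N + 1 := by exact_mod_cast h.2
  have hdet : ((M : ℝ) + N - 0) * (0 - 0) - ((M : ℝ) - 0) * ((K : ℝ) * N - 0) =
      -((K : ℝ) * M * N) := by ring
  simp only [PlaneTriangle.area, IT]
  rw [hdet, abs_neg, abs_of_nonneg (by positivity), hsol, add_sub_cancel_right]

theorem area_RT (h : IsSolution M N K) (hM : 0 < M) :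
    (RT M N K).area = ((M : ℝ) ^ 2 - 1 / K) / 2 := by
  have hsol : ((M : ℝ) + N) ^ 2 = K * M * N + 1 := by exact_mod_cast h.2
  have hK : (1 : ℝ) ≤ K := by exact_mod_cast (by linarith [h.1] : 1 ≤ K)
  have hM' : (1 : ℝ) ≤ M := by exact_mod_cast hM
  have hdet : ((M : ℝ) - 0) * (0 - 0) - ((M : ℝ) - ((M : ℝ) + N) / K - 0) * ((M : ℝ) + N - 0) =
      -((M : ℝ) ^ 2 - 1 / K) := by
    field_simp
    linear_combination hsol
  simp only [PlaneTriangle.area, RT]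
  rw [hdet, abs_neg, abs_of_nonneg]
  linarith [(div_le_one (by linarith)).2 hK, one_le_pow₀ hM' (n := 2)]

variable {k : Type*} [Field k]

theorem newtonPolygon_subset_IT_iff (h : IsSolution M N K) (hM : 0 < M) (hN : 0 < N)
    {f : LaurentRing k} : newtonPolygon f ⊆ (IT M N K).region ↔
      (f.coeff.support : Set (ℤ × ℤ)) ⊆ latticeTriangle ((M + N : ℕ) : ℤ) (K * N) K := by
  have hK : (K : ℝ) ≠ 0 := by exact_mod_cast (by linarith [h.1] : K ≠ 0)
  refine (h.isAdmissible_IT hM hN).newtonPolygon_subset_iff rfl (by simp [IT]) ?_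
  simp only [IT]
  push_cast
  rw [mul_div_cancel_left₀ _ hK, add_sub_cancel_right]

theorem newtonPolygon_subset_RT_iff (h : IsSolution M N K) (hM : 0 < M) {f : LaurentRing k} :
    newtonPolygon f ⊆ (RT M N K).region ↔
      (f.coeff.support : Set (ℤ × ℤ)) ⊆ latticeTriangle M ((M : ℤ) + N) K :=
  (h.isAdmissible_RT hM).newtonPolygon_subset_iff rfl (by simp [RT]) (by simp [RT])

end IsSolution

variable {k : Type*} [Field k] [CharZero k]

theorem exists_definesNegativeCurve_one (n : ℕ) :
    ∃ f : LaurentRing k, DefinesNegativeCurve f 1 ∧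
      ∀ u ∈ f.coeff.support, u = (0, 0) ∨ u = (1, (n : ℤ)) := by
  let f : LaurentRing k := single (1, (n : ℤ)) 1 - single (0, 0) 1
  have hsupp : ∀ u ∈ f.coeff.support, u = (0, 0) ∨ u = (1, (n : ℤ)) := by
    intro u hu
    by_contra! hne
    simp [f, Ne.symm hne.1, Ne.symm hne.2] at hu
  have hedge : HasPrimitiveUpperEdge (f.coeff.support : Set (ℤ × ℤ)) (1 : ℕ) n :=
    { pos := one_pos
      coprime := isCoprime_one_left
      zero_mem := by simp [f]
      corner_mem := by simp [f]
      fst_nonneg := fun u hu => by rcases hsupp u hu with rfl | rfl <;> simp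
      fst_le := fun u hu => by rcases hsupp u hu with rfl | rfl <;> simp
      below := fun u hu => by rcases hsupp u hu with rfl | rfl <;> simp
      snd_eq_zero := fun u hu => by rcases hsupp u hu with rfl | rfl <;> simp }
  have hmem : f ∈ idealE k := by
    have hf : f = single (0, 1) 1 ^ n * (single (1, 0) 1 - 1) + (single (0, 1) 1 ^ n - 1 ^ n) := by
      simp [f, mul_sub, single_pow, single_mul_single, one_def]
      rfl
    rw [hf]
    exact add_mem (Ideal.mul_mem_left _ _ (Ideal.subset_span (.inl rfl)))
      (Ideal.mem_of_dvd _ (sub_dvd_pow_sub_pow _ _ n) (Ideal.subset_span (.inr rfl)))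
  refine ⟨f, ⟨hedge.irreducible, ⟨by rwa [pow_one], hedge.notMem_idealE_pow⟩,
    ⟨(0, 0), (1, n), (0, 1)⟩, by simp [PlaneTriangle.area], by simp [PlaneTriangle.area], ?_⟩,
    hsupp⟩
  refine (newtonPolygon_subset_region_iff f _).2 fun u hu => subset_convexHull ℝ _ ?_
  rcases hsupp u hu with rfl | rfl <;> simp

theorem IsSolution.exists_supportsNegativeCurve_IT (h : IsSolution M N K) :
    ∃ f : LaurentRing k, SupportsNegativeCurve (IT M N K) (M + N) f := by
  have harea : (IT M N K).area ≤ ((M + N : ℕ) : ℝ) ^ 2 / 2 := by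
    rw [h.area_IT]
    push_cast
    linarith
  have degenerate (hMN : M + N = 1) : ∃ f : LaurentRing k,
      SupportsNegativeCurve (IT M N K) (M + N) f := by
    obtain ⟨f, hf, hsupp⟩ := exists_definesNegativeCurve_one (k := k) (K * N)
    refine ⟨f, harea, (newtonPolygon_subset_region_iff f _).2 fun u hu => ?_, hMN ▸ hf⟩
    have hMN' : (M : ℝ) + N = 1 := by exact_mod_cast hMN
    refine subset_convexHull ℝ _ ?_
    rcases hsupp u hu with rfl | rfl <;> simp [IT, hMN']
  rcases Nat.eq_zero_or_pos M with rfl | hM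
  · exact degenerate (by simpa using h.2)
  rcases Nat.eq_zero_or_pos N with rfl | hN
  · exact degenerate (by simpa using h.2)
  obtain ⟨f, hirr, hord, hsupp⟩ :=
    (h.isAdmissible_IT hM hN).exists_irreducible_vanishesToOrder (k := k)
  have hpoly := (h.newtonPolygon_subset_IT_iff hM hN).2 hsupp
  refine ⟨f, harea, hpoly, hirr, hord, _, ?_, harea, hpoly⟩
  have hMN : (1 : ℝ) < M + N := by exact_mod_cast (by omega : 1 < M + N)
  rw [h.area_IT]
  linarith [one_lt_pow₀ hMN two_ne_zero]

theorem IsSolution.exists_supportsNegativeCurve_RT (h : IsSolution M N K) (hM : 0 < M) :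
    ∃ f : LaurentRing k, SupportsNegativeCurve (RT M N K) M f := by
  have hM' : (1 : ℝ) ≤ M := by exact_mod_cast hM
  have hK : (1 : ℝ) < K := by exact_mod_cast (by linarith [h.1] : 1 < K)
  have harea : (RT M N K).area ≤ (M : ℝ) ^ 2 / 2 := by
    rw [h.area_RT hM]
    have : 0 < 1 / (K : ℝ) := by positivity
    linarith
  obtain ⟨f, hirr, hord, hsupp⟩ :=
    (h.isAdmissible_RT hM).exists_irreducible_vanishesToOrder (k := k)
  have hpoly := (h.newtonPolygon_subset_RT_iff hM).2 hsupp
  refine ⟨f, harea, hpoly, hirr, hord, _, ?_, harea, hpoly⟩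
  rw [h.area_RT hM]
  linarith [(div_lt_one (by linarith)).2 hK, one_le_pow₀ hM' (n := 2)]

end Existence

section Comparison

/-- The properties of the support `S` of a negative curve in the triangle with vertices `(0, 0)`,
`(m, m + r)` and `(m - (m + r) / K, 0)` by which such curves are told apart: it contains the first
two vertices, and its width in every direction is at least `m`. -/
structure IsNegativeSupport (S : Set (ℤ × ℤ)) (m r K : ℤ) : Prop where
  two_le : 2 ≤ m
  r_pos : 0 < r
  r_lt : r < m
  admissible : IsAdmissible m (m + r) K
  zero_mem : (0, 0) ∈ S
  corner_mem : (m, m + r) ∈ S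
  subset : S ⊆ latticeTriangle m (m + r) K
  width : ∀ a b : ℤ, IsCoprime a b → ∃ u ∈ S, ∃ v ∈ S,
    m ≤ (a * v.1 + b * v.2) - (a * u.1 + b * u.2)

/-- The linear part of `φ` has matrix `!![a, b; c, e]`, of determinant `ε = ±1`. -/
structure HasMatrix (φ : (ℤ × ℤ) ≃ᵃ[ℤ] (ℤ × ℤ)) (a b c e ε : ℤ) : Prop where
  sign : ε = 1 ∨ ε = -1
  det : a * e - b * c = ε
  apply : ∀ u, φ u = (a * u.1 + b * u.2 + (φ (0, 0)).1, c * u.1 + e * u.2 + (φ (0, 0)).2)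

variable {φ : (ℤ × ℤ) ≃ᵃ[ℤ] (ℤ × ℤ)} {S S' : Set (ℤ × ℤ)} {a b c e ε m m' r r' K K' : ℤ}

theorem exists_apply_eq_add (φ : (ℤ × ℤ) ≃ᵃ[ℤ] (ℤ × ℤ)) : ∃ a b c e : ℤ, ∀ u,
    φ u = (a * u.1 + b * u.2 + (φ (0, 0)).1, c * u.1 + e * u.2 + (φ (0, 0)).2) := by
  refine ⟨(φ.linear (1, 0)).1, (φ.linear (0, 1)).1, (φ.linear (1, 0)).2, (φ.linear (0, 1)).2,
    fun u => ?_⟩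
  have hφ : φ u = φ.linear u + φ (0, 0) := by
    simpa only [vadd_eq_add, Prod.mk_zero_zero, add_zero] using φ.map_vadd (0, 0) u
  have hu : u = u.1 • (1, 0) + u.2 • (0, 1) := by ext <;> simp
  have hlin : φ.linear u = u.1 • φ.linear (1, 0) + u.2 • φ.linear (0, 1) := by
    conv_lhs => rw [hu, map_add, map_smul, map_smul]
  rw [hφ, hlin]
  ext <;> simp [mul_comm]

theorem exists_hasMatrix (φ : (ℤ × ℤ) ≃ᵃ[ℤ] (ℤ × ℤ)) : ∃ a b c e ε : ℤ, HasMatrix φ a b c e ε := by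
  obtain ⟨a, b, c, e, hφ⟩ := exists_apply_eq_add φ
  obtain ⟨a', b', c', e', hψ⟩ := exists_apply_eq_add φ.symm
  have right_inverse (u) := (hφ (φ.symm u)).symm.trans (φ.apply_symm_apply u)
  have h₀ := Prod.ext_iff.1 (right_inverse (0, 0))
  have h₁ := Prod.ext_iff.1 (right_inverse (1, 0))
  have h₂ := Prod.ext_iff.1 (right_inverse (0, 1))
  rw [hψ] at h₁ h₂
  have hdet : (a * e - b * c) * (a' * e' - b' * c') = 1 := by
    have h₁₁ : a * a' + b * c' = 1 := by linear_combination h₁.1 - h₀.1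
    have h₂₁ : c * a' + e * c' = 0 := by linear_combination h₁.2 - h₀.2
    have h₂₂ : c * b' + e * e' = 1 := by linear_combination h₂.2 - h₀.2
    linear_combination (c * b' + e * e') * h₁₁ - (a * b' + b * e') * h₂₁ + h₂₂
  exact ⟨a, b, c, e, _, Int.eq_one_or_neg_one_of_mul_eq_one hdet, rfl, hφ⟩

namespace HasMatrix

theorem isCoprime (hφ : HasMatrix φ a b c e ε) : IsCoprime a b := by
  rcases hφ.sign with rfl | rfl
  · exact ⟨e, -c, by linear_combination hφ.det⟩
  · exact ⟨-e, c, by linear_combination -hφ.det⟩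

theorem symm (hφ : HasMatrix φ a b c e ε) :
    HasMatrix φ.symm (ε * e) (-(ε * b)) (-(ε * c)) (ε * a) ε := by
  have hε : ε * ε = 1 := by rcases hφ.sign with h | h <;> simp [h]
  refine ⟨hφ.sign, by linear_combination ε * ε * hφ.det + ε * hε, fun u => φ.injective ?_⟩
  have h₀ := (hφ.apply (φ.symm (0, 0))).symm.trans (φ.apply_symm_apply _)
  rw [Prod.ext_iff] at h₀
  rw [φ.apply_symm_apply, hφ.apply]
  ext
  · linear_combination -h₀.1 - (ε * u.1) * hφ.det - u.1 * hε
  · linear_combination -h₀.2 - (ε * u.2) * hφ.det - u.2 * hε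

end HasMatrix

namespace IsNegativeSupport

theorem isCoprime (hS : IsNegativeSupport S m r K) : IsCoprime m r :=
  (IsCoprime.add_mul_left_right_iff (z := 1)).1 (by simpa [add_comm] using hS.admissible.coprime)

theorem fst_nonneg (hS : IsNegativeSupport S m r K) {u : ℤ × ℤ} (hu : u ∈ S) : 0 ≤ u.1 :=
  hS.admissible.fst_nonneg (hS.subset hu)

theorem fst_le (hS : IsNegativeSupport S m r K) {u : ℤ × ℤ} (hu : u ∈ S) : u.1 ≤ m :=
  hS.admissible.fst_le (hS.subset hu)

theorem snd_nonneg (hS : IsNegativeSupport S m r K) {u : ℤ × ℤ} (hu : u ∈ S) : 0 ≤ u.2 :=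
  (hS.subset hu).1

theorem le_snd (hS : IsNegativeSupport S m r K) {u : ℤ × ℤ} (hu : u ∈ S) :
    m + r + K * (u.1 - m) ≤ u.2 :=
  (hS.subset hu).2.1

theorem mul_snd_le (hS : IsNegativeSupport S m r K) {u : ℤ × ℤ} (hu : u ∈ S) :
    m * u.2 ≤ (m + r) * u.1 :=
  (hS.subset hu).2.2

theorem snd_sub_fst_le (hS : IsNegativeSupport S m r K) {u : ℤ × ℤ} (hu : u ∈ S) :
    u.2 - u.1 ≤ r := by
  have hm : 0 < m := hS.admissible.m_pos
  refine le_of_mul_le_mul_left ?_ hm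
  linarith [hS.mul_snd_le hu, mul_le_mul_of_nonneg_left (hS.fst_le hu) hS.r_pos.le]

theorem snd_le_two_mul_fst (hS : IsNegativeSupport S m r K) {u : ℤ × ℤ} (hu : u ∈ S) :
    u.2 ≤ 2 * u.1 := by
  refine le_of_mul_le_mul_left ?_ hS.admissible.m_pos
  linarith [hS.mul_snd_le hu, mul_le_mul_of_nonneg_right hS.r_lt.le (hS.fst_nonneg hu)]

-- The width in the direction `(g, 1)`, where `g` is either integer next to `a / b`, already bounds
-- the width in the direction `(a, b)` from below by `(|b| - |a - b g|) m`.
theorem mul_le_of_width_le (hS : IsNegativeSupport S m r K) (hb : 0 < b)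
    (hw : ∀ u ∈ S, ∀ v ∈ S, (a * v.1 + b * v.2) - (a * u.1 + b * u.2) ≤ m) (g : ℤ) :
    b ≤ 1 + |a - b * g| := by
  obtain ⟨u, hu, v, hv, huv⟩ := hS.width g 1 isCoprime_one_right
  have hdiff : |v.1 - u.1| ≤ m := by
    rw [abs_le]
    constructor <;> linarith [hS.fst_nonneg hu, hS.fst_le hu, hS.fst_nonneg hv, hS.fst_le hv]
  refine le_of_mul_le_mul_right ?_ hS.admissible.m_pos
  have hcross : -((a - b * g) * (v.1 - u.1)) ≤ |a - b * g| * m :=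
    (neg_le_abs _).trans ((abs_mul _ _).trans_le (mul_le_mul_of_nonneg_left hdiff (abs_nonneg _)))
  linarith [hw u hu v hv, mul_le_mul_of_nonneg_left huv hb.le]

theorem ne_two_of_width_le (hS : IsNegativeSupport S m r K) (hab : IsCoprime a b)
    (hw : ∀ u ∈ S, ∀ v ∈ S, (a * v.1 + b * v.2) - (a * u.1 + b * u.2) ≤ m) : b ≠ 2 := by
  rintro rfl
  obtain ⟨g, rfl⟩ : Odd a := Int.isCoprime_two_right.1 hab
  obtain ⟨u, hu, v, hv, huv⟩ := hS.width g 1 isCoprime_one_right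
  have hnarrow := hw u hu v hv
  have hu₁ : u.1 = m := by linarith [hS.fst_le hu, hS.fst_nonneg hv]
  have hv₁ : v.1 = 0 := by linarith [hS.fst_le hu, hS.fst_nonneg hv]
  obtain rfl := hS.admissible.eq_corner_of_fst_eq (hS.subset hu) hu₁
  obtain rfl := hS.admissible.eq_zero_of_fst_eq_zero (hS.subset hv) hv₁
  simp only [Prod.fst_zero, Prod.snd_zero] at huv hnarrow
  have hdvd : m ∣ r := ⟨-(g + 2), by linarith⟩
  exact (Int.le_of_dvd hS.r_pos hdvd).not_gt hS.r_lt

theorem eq_of_width_le (hS : IsNegativeSupport S m r K) (hb : 0 < b) (hab : IsCoprime a b)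
    (hw : ∀ u ∈ S, ∀ v ∈ S, (a * v.1 + b * v.2) - (a * u.1 + b * u.2) ≤ m) :
    b = 1 ∧ (a = -1 ∨ a = -2) := by
  have hm := hS.admissible.m_pos
  have hb₂ : b ≤ 2 := by
    have hlow := hS.mul_le_of_width_le hb hw (a / b)
    have hhigh := hS.mul_le_of_width_le hb hw (a / b + 1)
    have hdiv := Int.emod_add_mul_ediv a b
    have hmod₀ := Int.emod_nonneg a hb.ne'
    have hmod := Int.emod_lt_of_pos a hb
    rw [show a - b * (a / b) = a % b by linarith, abs_of_nonneg hmod₀] at hlow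
    rw [show a - b * (a / b + 1) = -(b - a % b) by linarith, abs_neg,
      abs_of_pos (sub_pos.2 hmod)] at hhigh
    linarith
  obtain rfl : b = 1 := by have := hS.ne_two_of_width_le hab hw; omega
  have hright := hw _ hS.zero_mem _ hS.corner_mem
  have hleft := hw _ hS.corner_mem _ hS.zero_mem
  simp only [mul_zero, add_zero, zero_sub, sub_zero, one_mul] at hright hleft
  have hr := hS.r_pos
  have hrm := hS.r_lt
  have hup : a + 1 < 1 := lt_of_mul_lt_mul_right (by linarith) hm.le
  have hlow : -2 < a + 1 := lt_of_mul_lt_mul_right (by linarith) hm.le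
  exact ⟨rfl, by omega⟩

end IsNegativeSupport

section Identification

theorem forall_symm_mem_iff (h : ∀ u, φ u ∈ S' ↔ u ∈ S) (u : ℤ × ℤ) : φ.symm u ∈ S ↔ u ∈ S' := by
  rw [← h, φ.apply_symm_apply]

theorem exists_mem_apply_eq (h : ∀ u, φ u ∈ S' ↔ u ∈ S) {p : ℤ × ℤ} (hp : p ∈ S') :
    ∃ u ∈ S, φ u = p :=
  ⟨φ.symm p, (forall_symm_mem_iff h p).2 hp, φ.apply_symm_apply p⟩

namespace IsNegativeSupport

theorem order_le (hS : IsNegativeSupport S m r K) (hS' : IsNegativeSupport S' m' r' K')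
    (h : ∀ u, φ u ∈ S' ↔ u ∈ S) (hφ : HasMatrix φ a b c e ε) : m ≤ m' := by
  obtain ⟨u, hu, v, hv, huv⟩ := hS.width a b hφ.isCoprime
  have hu' := hS'.fst_nonneg ((h u).2 hu)
  have hv' := hS'.fst_le ((h v).2 hv)
  rw [hφ.apply] at hu' hv'
  linarith

theorem apply_eq_corner (hS' : IsNegativeSupport S' m' r' K') (h : ∀ u, φ u ∈ S' ↔ u ∈ S)
    {p : ℤ × ℤ} (hp : p ∈ S) (hmax : ∀ u ∈ S, (φ u).1 ≤ (φ p).1) : φ p = (m', m' + r') := by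
  obtain ⟨u, hu, hφu⟩ := exists_mem_apply_eq h hS'.corner_mem
  have hle : m' ≤ (φ p).1 := by simpa [hφu] using hmax u hu
  have hp' := (h p).2 hp
  exact hS'.admissible.eq_corner_of_fst_eq (hS'.subset hp') ((hS'.fst_le hp').antisymm hle)

theorem apply_eq_zero (hS' : IsNegativeSupport S' m' r' K') (h : ∀ u, φ u ∈ S' ↔ u ∈ S)
    {p : ℤ × ℤ} (hp : p ∈ S) (hmin : ∀ u ∈ S, (φ p).1 ≤ (φ u).1) : φ p = (0, 0) := by
  obtain ⟨u, hu, hφu⟩ := exists_mem_apply_eq h hS'.zero_mem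
  have hle : (φ p).1 ≤ 0 := by simpa [hφu] using hmin u hu
  have hp' := (h p).2 hp
  exact hS'.admissible.eq_zero_of_fst_eq_zero (hS'.subset hp') (hle.antisymm (hS'.fst_nonneg hp'))

theorem slanted_cases (hS : IsNegativeSupport S m r K) (hS' : IsNegativeSupport S' m r' K')
    (h : ∀ u, φ u ∈ S' ↔ u ∈ S) (hφ : HasMatrix φ a b c e ε) (hb : b ≠ 0) :
    (a = -1 ∧ b = 1 ∧ φ (m, m + r) = (m, m + r')) ∨ (a = 1 ∧ b = -1 ∧ φ (m, m + r) = (0, 0)) ∨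
    (a = -2 ∧ b = 1 ∧ φ (0, 0) = (m, m + r')) ∨ (a = 2 ∧ b = -1 ∧ φ (0, 0) = (0, 0)) := by
  have hw : ∀ u ∈ S, ∀ v ∈ S, (a * v.1 + b * v.2) - (a * u.1 + b * u.2) ≤ m := by
    intro u hu v hv
    have hu' := hS'.fst_nonneg ((h u).2 hu)
    have hv' := hS'.fst_le ((h v).2 hv)
    rw [hφ.apply] at hu' hv'
    linarith
  have hfst (u) : (φ u).1 = a * u.1 + b * u.2 + (φ (0, 0)).1 := congrArg Prod.fst (hφ.apply u)
  rcases lt_or_gt_of_ne hb with hb | hb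
  · obtain ⟨hb', ha⟩ := hS.eq_of_width_le (neg_pos.2 hb) hφ.isCoprime.neg_neg
      fun u hu v hv => by linarith [hw v hv u hu]
    obtain rfl : b = -1 := by omega
    rcases ha with ha | ha
    · obtain rfl : a = 1 := by omega
      refine .inr (.inl ⟨rfl, rfl, hS'.apply_eq_zero h hS.corner_mem fun u hu => ?_⟩)
      rw [hfst, hfst u]
      linarith [hS.snd_sub_fst_le hu]
    · obtain rfl : a = 2 := by omega
      refine .inr (.inr (.inr ⟨rfl, rfl, hS'.apply_eq_zero h hS.zero_mem fun u hu => ?_⟩))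
      rw [hfst u]
      linarith [hS.snd_le_two_mul_fst hu]
  · obtain ⟨rfl, rfl | rfl⟩ := hS.eq_of_width_le hb hφ.isCoprime hw
    · refine .inl ⟨rfl, rfl, hS'.apply_eq_corner h hS.corner_mem fun u hu => ?_⟩
      rw [hfst, hfst (m, m + r)]
      linarith [hS.snd_sub_fst_le hu]
    · refine .inr (.inr (.inl ⟨rfl, rfl, hS'.apply_eq_corner h hS.zero_mem fun u hu => ?_⟩))
      rw [hfst]
      linarith [hS.snd_le_two_mul_fst hu]

theorem vertical_cases (hS : IsNegativeSupport S m r K) (hS' : IsNegativeSupport S' m r' K')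
    (h : ∀ u, φ u ∈ S' ↔ u ∈ S) (hφ : HasMatrix φ a 0 c e ε) :
    (a = 1 ∧ φ (0, 0) = (0, 0) ∧ φ (m, m + r) = (m, m + r')) ∨
      (a = -1 ∧ φ (0, 0) = (m, m + r') ∧ φ (m, m + r) = (0, 0)) := by
  have hfst (u) : (φ u).1 = a * u.1 + (φ (0, 0)).1 := by
    simpa using congrArg Prod.fst (hφ.apply u)
  rcases Int.isUnit_iff.1 (isCoprime_zero_right.1 hφ.isCoprime) with rfl | rfl
  · refine .inl ⟨rfl, hS'.apply_eq_zero h hS.zero_mem fun u hu => ?_,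
      hS'.apply_eq_corner h hS.corner_mem fun u hu => ?_⟩
    · rw [hfst u]
      linarith [hS.fst_nonneg hu]
    · rw [hfst u, hfst (m, m + r)]
      linarith [hS.fst_le hu]
  · refine .inr ⟨rfl, hS'.apply_eq_corner h hS.zero_mem fun u hu => ?_,
      hS'.apply_eq_zero h hS.corner_mem fun u hu => ?_⟩
    · rw [hfst u]
      linarith [hS.fst_nonneg hu]
    · rw [hfst u, hfst (m, m + r)]
      linarith [hS.fst_le hu]

theorem vertical_snd_coeff_eq_one (hS : IsNegativeSupport S m r K)
    (hS' : IsNegativeSupport S' m r' K') (h : ∀ u, φ u ∈ S' ↔ u ∈ S)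
    (hφ : HasMatrix φ a 0 c e ε) : e = 1 := by
  have hcases := hS.vertical_cases hS' h hφ
  obtain rfl | rfl : e = 1 ∨ e = -1 := by
    have hdet := hφ.det
    rcases hφ.sign with rfl | rfl <;> rcases hcases with ⟨rfl, -⟩ | ⟨rfl, -⟩ <;> omega
  · rfl
  -- The height below the upper edge vanishes at both ends of that edge, so `φ` would reverse it.
  have hheight (u) : (m + r') * (φ u).1 - m * (φ u).2 = m * u.2 - (m + r) * u.1 := by
    have hcorner := hφ.apply (m, m + r)
    rw [hφ.apply]
    rcases hcases with ⟨rfl, h₀, h₁⟩ | ⟨rfl, h₀, h₁⟩ <;>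
      simp only [h₀, h₁, Prod.mk.injEq] at hcorner ⊢ <;>
      linear_combination u.1 * hcorner.2
  have hzero (u) (hu : u ∈ S) : (m + r) * u.1 + -m * u.2 = 0 := by
    linarith [hheight u, hS.mul_snd_le hu, hS'.mul_snd_le ((h u).2 hu)]
  obtain ⟨u, hu, v, hv, huv⟩ := hS.width (m + r) (-m) hS.admissible.coprime.symm.neg_right
  rw [hzero u hu, hzero v hv] at huv
  linarith [hS.two_le]

theorem eq_of_reflection (hS : IsNegativeSupport S m r K) (hS' : IsNegativeSupport S' m r' K')
    (h : ∀ u, φ u ∈ S' ↔ u ∈ S) (hrr' : r + r' = m)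
    (hφ : ∀ u, φ u = (m - u.1, u.2 - 3 * u.1 + m + r')) : r = r' := by
  have hr : m ≤ 2 * r := by
    obtain ⟨u, hu, v, hv, huv⟩ := hS.width 1 (-1) isCoprime_one_left
    have hv' := hS'.snd_nonneg ((h v).2 hv)
    rw [hφ] at hv'
    linarith [hS.snd_sub_fst_le hu, hS.snd_nonneg hv]
  have hr' : m ≤ 2 * r' := by
    obtain ⟨u, hu, v, hv, huv⟩ := hS'.width 1 (-1) isCoprime_one_left
    obtain ⟨w, hw, rfl⟩ := exists_mem_apply_eq h hv
    have hv' := hS'.snd_nonneg hv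
    have hw' := hS.snd_nonneg hw
    have hu' := hS'.snd_sub_fst_le hu
    simp only [hφ] at huv hv'
    linarith
  linarith

theorem eq_of_vertical (hS : IsNegativeSupport S m r K) (hS' : IsNegativeSupport S' m r' K')
    (h : ∀ u, φ u ∈ S' ↔ u ∈ S) (hφ : HasMatrix φ a 0 c e ε) : r = r' := by
  obtain rfl := hS.vertical_snd_coeff_eq_one hS' h hφ
  have hcorner := hφ.apply (m, m + r)
  rcases hS.vertical_cases hS' h hφ with ⟨rfl, h₀, h₁⟩ | ⟨rfl, h₀, h₁⟩
  · have hc : c * m = r' - r := by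
      simp only [h₀, h₁, Prod.ext_iff] at hcorner
      linarith [hcorner.2]
    have := Int.eq_zero_of_abs_lt_dvd ⟨c, by linarith⟩ (abs_sub_lt_of_nonneg_of_lt hS'.r_pos.le
      hS'.r_lt hS.r_pos.le hS.r_lt)
    linarith
  · have hc : (c + 2) * m = -(r + r') := by
      simp only [h₀, h₁, Prod.ext_iff] at hcorner
      linarith [hcorner.2]
    have hlow : -2 < c + 2 := lt_of_mul_lt_mul_right
      (by linarith [hS.r_lt, hS'.r_lt]) hS.admissible.m_pos.le
    have hup : c + 2 < 0 := neg_of_mul_neg_left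
      (by linarith [hS.r_pos, hS'.r_pos]) hS.admissible.m_pos.le
    obtain rfl : c = -3 := by omega
    refine hS.eq_of_reflection hS' h (by linarith) fun u => ?_
    rw [hφ.apply, h₀]
    ext <;> ring

theorem eq_of_shear (hS : IsNegativeSupport S m r K) (hS' : IsNegativeSupport S' m r' K')
    (h : ∀ u, φ u ∈ S' ↔ u ∈ S) (hφ : ∀ u, φ u = (u.2 - u.1 + m - r, u.2 + r' - r)) :
    r = r' := by
  refine le_antisymm ?_ ?_
  · have h₀ := hS'.snd_nonneg ((h _).2 hS.zero_mem)
    rw [hφ] at h₀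
    linarith
  · obtain ⟨u, hu, hφu⟩ := exists_mem_apply_eq h hS'.zero_mem
    have hsnd := congrArg Prod.snd ((hφ u).symm.trans hφu)
    linarith [hS.snd_nonneg hu]

theorem eq_of_involution (hS : IsNegativeSupport S m r K) (hS' : IsNegativeSupport S' m r' K')
    (h : ∀ u, φ u ∈ S' ↔ u ∈ S) (hφ : ∀ u, φ u = (2 * u.1 - u.2, 3 * u.1 - 2 * u.2)) :
    r = r' := by
  have hr : 2 * r ≤ m := by
    have h₁ := hS'.snd_nonneg ((h _).2 hS.corner_mem)
    rw [hφ] at h₁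
    linarith
  have hr' : 2 * r' ≤ m := by
    obtain ⟨u, hu, hφu⟩ := exists_mem_apply_eq h hS'.corner_mem
    rw [hφ, Prod.mk.injEq] at hφu
    linarith [hS.snd_nonneg hu]
  obtain ⟨u, hu, v, hv, huv⟩ := hS.width (-1) 1 isCoprime_one_right
  have hu' := hS'.snd_sub_fst_le ((h u).2 hu)
  rw [hφ] at hu'
  linarith [hS.snd_sub_fst_le hv]

theorem area_excess (hS : IsNegativeSupport S m r K) :
    0 < m ^ 2 + r ^ 2 - (K - 2) * m * r ∧ m ^ 2 + r ^ 2 - (K - 2) * m * r ≤ K :=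
  ⟨by linarith [hS.admissible.area_lt], by linarith [hS.admissible.le_area]⟩

theorem steep_cases (hS : IsNegativeSupport S m r K) (hsteep : m ≤ 2 * r) :
    (m = 2 ∧ r = 1) ∨ (K = 4 ∧ (r = m - 1 ∨ r = m - 2)) := by
  obtain ⟨hpos, hle⟩ := hS.area_excess
  have hr := hS.r_pos
  have hrm := hS.r_lt
  have hm := hS.two_le
  have hK₄ : K ≤ 4 := by
    by_contra! hK
    have : 3 * (m * r) ≤ (K - 2) * (m * r) := by gcongr; linarith
    nlinarith
  have hK₃ : 3 ≤ K := by
    by_contra! hK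
    have : (K - 2) * (m * r) ≤ 0 := mul_nonpos_of_nonpos_of_nonneg (by omega) (by positivity)
    nlinarith
  obtain rfl | rfl : K = 3 ∨ K = 4 := by omega
  · refine .inl ?_
    have : m < 3 := by nlinarith
    omega
  · refine .inr ⟨rfl, ?_⟩
    have : m - r < 3 := by nlinarith
    omega

-- Such a map forces both triangles to be steep, which leaves few possibilities.
theorem eq_of_rotation (hS : IsNegativeSupport S m r K) (hS' : IsNegativeSupport S' m r' K')
    (h : ∀ u, φ u ∈ S' ↔ u ∈ S)
    (hφ : ∀ u, φ u = (u.1 - u.2 + r, 3 * u.1 - 2 * u.2 + 2 * r - m)) : r = r' := by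
  have hzero := (h _).2 hS.zero_mem
  obtain ⟨w, hw, hφw⟩ := exists_mem_apply_eq h hS'.corner_mem
  obtain rfl : w = (r', r' + r - m) := by
    rw [hφ, Prod.mk.injEq] at hφw
    ext <;> simp only <;> linarith
  have hsteep : m ≤ 2 * r := by
    have := hS'.snd_nonneg hzero
    rw [hφ] at this
    linarith
  have hsteep' : m ≤ 2 * r' := by
    obtain ⟨u, hu, v, hv, huv⟩ := hS'.width 1 (-1) isCoprime_one_left
    obtain ⟨w, hw, rfl⟩ := exists_mem_apply_eq h hv
    have hv' := hS'.snd_nonneg hv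
    have hw' := hS.fst_nonneg hw
    have hu' := hS'.snd_sub_fst_le hu
    simp only [hφ] at huv hv'
    linarith
  have hright := hS'.le_snd hzero
  have hright' := hS.le_snd hw
  simp only [hφ] at hright
  have hcop := hS'.isCoprime
  have hrm := hS.r_lt
  have hrm' := hS'.r_lt
  rcases hS.steep_cases hsteep with ⟨rfl, rfl⟩ | ⟨rfl, hr⟩
  · omega
  rcases hS'.steep_cases hsteep' with ⟨rfl, rfl⟩ | ⟨rfl, hr'⟩
  · omega
  have hfour : ¬ (m = 4 ∧ r' = 2) := by
    rintro ⟨rfl, rfl⟩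
    norm_num [Int.isCoprime_iff_gcd_eq_one] at hcop
  omega

-- Both `φ` and its inverse are subject to `slanted_cases`; only four of the combinations survive.
theorem slanted_matrix (hS : IsNegativeSupport S m r K) (hS' : IsNegativeSupport S' m r' K')
    (h : ∀ u, φ u ∈ S' ↔ u ∈ S) (hφ : HasMatrix φ a b c e ε) (hb : b ≠ 0) :
    (a = -1 ∧ b = 1 ∧ c = 0 ∧ e = 1 ∧ φ (m, m + r) = (m, m + r')) ∨
    (a = 2 ∧ b = -1 ∧ c = 3 ∧ e = -2 ∧ φ (0, 0) = (0, 0)) ∨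
    (a = 1 ∧ b = -1 ∧ c = 3 ∧ e = -2 ∧ φ (m, m + r) = (0, 0)) ∨
    (a = -2 ∧ b = 1 ∧ c = -3 ∧ e = 1 ∧ φ (0, 0) = (m, m + r')) := by
  have hr := hS.r_pos
  have hrm := hS.r_lt
  have hdet := hφ.det
  have hcorner := congrArg Prod.fst (hφ.apply (m, m + r))
  have hcases' := hS'.slanted_cases hS (forall_symm_mem_iff h) hφ.symm
  simp only [φ.symm_apply_eq, eq_comm (b := φ _), neg_ne_zero] at hcases'
  rcases hφ.sign with rfl | rfl <;>
    rcases hS.slanted_cases hS' h hφ hb with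
      ⟨rfl, rfl, h₀⟩ | ⟨rfl, rfl, h₀⟩ | ⟨rfl, rfl, h₀⟩ | ⟨rfl, rfl, h₀⟩ <;>
    grind

theorem eq_of_slanted (hS : IsNegativeSupport S m r K) (hS' : IsNegativeSupport S' m r' K')
    (h : ∀ u, φ u ∈ S' ↔ u ∈ S) (hφ : HasMatrix φ a b c e ε) (hb : b ≠ 0) : r = r' := by
  have hcorner := hφ.apply (m, m + r)
  rcases hS.slanted_matrix hS' h hφ hb with ⟨rfl, rfl, rfl, rfl, h₁⟩ | ⟨rfl, rfl, rfl, rfl, h₀⟩ |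
    ⟨rfl, rfl, rfl, rfl, h₁⟩ | ⟨rfl, rfl, rfl, rfl, h₀⟩
  · rw [h₁, Prod.mk.injEq] at hcorner
    refine hS.eq_of_shear hS' h fun u => ?_
    rw [hφ.apply]
    ext <;> linarith
  · refine hS.eq_of_involution hS' h fun u => ?_
    rw [hφ.apply, h₀]
    ext <;> ring
  · rw [h₁, Prod.mk.injEq] at hcorner
    refine hS.eq_of_rotation hS' h fun u => ?_
    rw [hφ.apply]
    ext <;> linarith
  · refine (hS'.eq_of_rotation hS (forall_symm_mem_iff h) fun u => ?_).symm
    rw [φ.symm_apply_eq, hφ.apply, h₀]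
    ext <;> ring

theorem eq_of_affineEquiv (hS : IsNegativeSupport S m r K) (hS' : IsNegativeSupport S' m' r' K')
    (h : ∀ u, φ u ∈ S' ↔ u ∈ S) : m = m' ∧ r = r' := by
  obtain ⟨a, b, c, e, ε, hφ⟩ := exists_hasMatrix φ
  have h' := forall_symm_mem_iff h
  obtain rfl := (hS.order_le hS' h hφ).antisymm (hS'.order_le hS h' hφ.symm)
  refine ⟨rfl, ?_⟩
  rcases eq_or_ne b 0 with rfl | hb
  · exact hS.eq_of_vertical hS' h hφ
  · exact hS.eq_of_slanted hS' h hφ hb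

end IsNegativeSupport

end Identification

end Comparison

section Curves

variable {k : Type*} [Field k] {f g : LaurentRing k} {M N K M' N' K' : ℕ}

theorem IsNegativeSupport.eq_of_isomorphicCurves {m r K m' r' K' : ℤ}
    (hf : IsNegativeSupport (f.coeff.support : Set (ℤ × ℤ)) m r K)
    (hg : IsNegativeSupport (g.coeff.support : Set (ℤ × ℤ)) m' r' K')
    (hfg : IsomorphicCurves f g) : m = m' ∧ r = r' := by
  obtain ⟨φ, hφ⟩ := hfg.exists_affineEquiv
  exact hf.eq_of_affineEquiv hg hφ

/-- The slope of the upper edge of `IT M N K` is `1 + (N + δ) / (M + N)`. -/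
theorem IsSolution.exists_excess (h : IsSolution M N K) (hNM : N ≤ M) (hN : 0 < N) :
    ∃ δ : ℤ, 0 ≤ δ ∧ δ < M ∧ M * δ = N ^ 2 - 1 ∧ (K : ℤ) * N = M + 2 * N + δ := by
  have hN' : (1 : ℤ) ≤ N := by exact_mod_cast hN
  have hNM' : (N : ℤ) ≤ M := by exact_mod_cast hNM
  have hM : (0 : ℤ) < M := by linarith
  have hδ : (M : ℤ) * (K * N - M - 2 * N) = N ^ 2 - 1 := by linear_combination -h.natCast_eq
  refine ⟨K * N - M - 2 * N, ?_, ?_, hδ, by ring⟩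
  · refine nonneg_of_mul_nonneg_right ?_ hM
    rw [hδ]
    linarith [one_le_pow₀ hN' (n := 2)]
  · refine lt_of_mul_lt_mul_left ?_ hM.le
    rw [hδ]
    linarith [mul_le_mul hNM' hNM' (by linarith) hM.le]

variable [CharZero k]

theorem isNegativeSupport_coeff_support {m : ℕ} {r K : ℤ} (hm : 2 ≤ m) (hr : 0 < r) (hrm : r < m)
    (hadm : IsAdmissible m (m + r) K) (hirr : Irreducible f) (hf : f ∈ idealE k ^ m)
    (hsupp : (f.coeff.support : Set (ℤ × ℤ)) ⊆ latticeTriangle m (m + r) K) :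
    IsNegativeSupport (f.coeff.support : Set (ℤ × ℤ)) m r K where
  two_le := by exact_mod_cast hm
  r_pos := hr
  r_lt := hrm
  admissible := hadm
  zero_mem := hadm.zero_mem_support hirr.ne_zero hf hsupp
  corner_mem := hadm.corner_mem_support hirr.ne_zero hf hsupp
  subset := hsupp
  width _ _ hab := exists_width_ge hm hirr hf hab

theorem SupportsNegativeCurve.isNegativeSupport_IT
    (hf : SupportsNegativeCurve (IT M N K) (M + N) f) (h : IsSolution M N K) (hNM : N ≤ M)
    (hN : 0 < N) :
    IsNegativeSupport (f.coeff.support : Set (ℤ × ℤ)) ((M + N : ℕ) : ℤ) (K * N - (M + N : ℕ))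
      K := by
  obtain ⟨-, hpoly, hirr, ⟨hord, -⟩, -⟩ := hf
  obtain ⟨δ, hδ₀, hδM, -, hKN⟩ := h.exists_excess hNM hN
  have hM : 0 < M := hN.trans_le hNM
  refine isNegativeSupport_coeff_support (by omega) (by omega) (by omega) ?_ hirr hord ?_ <;>
    rw [add_sub_cancel]
  · exact h.isAdmissible_IT hM hN
  · exact (h.newtonPolygon_subset_IT_iff hM hN).1 hpoly

theorem SupportsNegativeCurve.isNegativeSupport_RT
    (hf : SupportsNegativeCurve (RT M N K) M f) (h : IsSolution M N K) (hNM : N < M)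
    (hN : 0 < N) : IsNegativeSupport (f.coeff.support : Set (ℤ × ℤ)) M N K := by
  obtain ⟨-, hpoly, hirr, ⟨hord, -⟩, -⟩ := hf
  have hM : 0 < M := hN.trans hNM
  exact isNegativeSupport_coeff_support (by omega) (by omega) (by omega) (h.isAdmissible_RT hM)
    hirr hord ((h.newtonPolygon_subset_RT_iff hM).1 hpoly)

theorem not_isomorphicCurves_IT (h : IsSolution M N K) (hNM : N ≤ M) (hN : 0 < N)
    (h' : IsSolution M' N' K') (hNM' : N' ≤ M') (hN' : 0 < N') (hne : (M, N) ≠ (M', N'))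
    (hf : SupportsNegativeCurve (IT M N K) (M + N) f)
    (hg : SupportsNegativeCurve (IT M' N' K') (M' + N') g) : ¬ IsomorphicCurves f g := by
  intro hfg
  obtain ⟨hm, hr⟩ := (hf.isNegativeSupport_IT h hNM hN).eq_of_isomorphicCurves
    (hg.isNegativeSupport_IT h' hNM' hN') hfg
  have hKN : (K : ℤ) * N = K' * N' := by linarith
  have hK : 0 < K := by linarith [h.1]
  have hsq : (K : ℤ) * N * M = K * N * M' := by
    have heq := h.natCast_eq
    have heq' := h'.natCast_eq
    push_cast at hm
    rw [← hm] at heq'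
    linear_combination heq' - heq - M' * hKN
  have hM : (M : ℤ) = M' := mul_left_cancel₀ (by positivity) hsq
  exact hne (Prod.ext (by omega) (by omega))

theorem not_isomorphicCurves_RT (h : IsSolution M N K) (hNM : N < M) (hN : 0 < N)
    (h' : IsSolution M' N' K') (hNM' : N' < M') (hN' : 0 < N') (hne : (M, N) ≠ (M', N'))
    (hf : SupportsNegativeCurve (RT M N K) M f)
    (hg : SupportsNegativeCurve (RT M' N' K') M' g) : ¬ IsomorphicCurves f g := by
  intro hfg
  obtain ⟨hM, hN⟩ := (hf.isNegativeSupport_RT h hNM hN).eq_of_isomorphicCurves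
    (hg.isNegativeSupport_RT h' hNM' hN') hfg
  exact hne (Prod.ext (by omega) (by omega))

theorem not_isomorphicCurves_IT_RT (h : IsSolution M N K) (hNM : N ≤ M) (hN : 0 < N)
    (h' : IsSolution M' N' K') (hNM' : N' < M') (hN' : 1 < N')
    (hf : SupportsNegativeCurve (IT M N K) (M + N) f)
    (hg : SupportsNegativeCurve (RT M' N' K') M' g) : ¬ IsomorphicCurves f g := by
  intro hfg
  have hS := hf.isNegativeSupport_IT h hNM hN
  obtain ⟨hm, hr⟩ := hS.eq_of_isomorphicCurves
    (hg.isNegativeSupport_RT h' hNM' (by omega)) hfg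
  obtain ⟨δ, hδ₀, hδM, hδ, hKN⟩ := h.exists_excess hNM hN
  have hcop : IsCoprime (M' : ℤ) N' := hm ▸ hr ▸ hS.isCoprime
  have hNδ : (N' : ℤ) = N + δ := by omega
  -- Modulo the common order, `N' ^ 2 ≡ 1` and `N' * N ≡ 1`, hence `N' * δ ≡ 0`.
  have hsq : (M' : ℤ) ∣ N' ^ 2 - 1 :=
    ⟨K' * N' - M' - 2 * N', by linear_combination h'.natCast_eq⟩
  have hmul : (M' : ℤ) ∣ N' * N - 1 := by
    refine ⟨δ, ?_⟩
    push_cast at hm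
    rw [← hm, hNδ]
    linear_combination -hδ
  have hdvd : (M' : ℤ) ∣ δ := by
    refine hcop.dvd_of_dvd_mul_left ?_
    convert dvd_sub hsq hmul using 1
    rw [hNδ]
    ring
  have hδ_zero : δ = 0 := Int.eq_zero_of_dvd_of_nonneg_of_lt hδ₀ (by omega) hdvd
  have hN_one : (N : ℤ) ^ 2 = 1 := by linear_combination M * hδ_zero - hδ
  have := (pow_eq_one_iff_of_nonneg (Int.natCast_nonneg N) two_ne_zero).1 hN_one
  omega

end Curves

theorem theorem1p1_general {k : Type*} [Field k] [CharZero k] :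
    (∀ M N K : ℕ, IsSolution M N K →
      (∃ f : LaurentRing k, SupportsNegativeCurve (IT M N K) (M + N) f) ∧
      (0 < M → ∃ f : LaurentRing k, SupportsNegativeCurve (RT M N K) M f)) ∧
    (∀ M N K M' N' K' : ℕ, IsSolution M N K → N ≤ M → 0 < N →
      IsSolution M' N' K' → N' ≤ M' → 0 < N' → (M, N) ≠ (M', N') →
      ∀ f g : LaurentRing k, SupportsNegativeCurve (IT M N K) (M + N) f →
        SupportsNegativeCurve (IT M' N' K') (M' + N') g → ¬ IsomorphicCurves f g) ∧
    (∀ M N K M' N' K' : ℕ, IsSolution M N K → N < M → 0 < N →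
      IsSolution M' N' K' → N' < M' → 0 < N' → (M, N) ≠ (M', N') →
      ∀ f g : LaurentRing k, SupportsNegativeCurve (RT M N K) M f →
        SupportsNegativeCurve (RT M' N' K') M' g → ¬ IsomorphicCurves f g) ∧
    (∀ M N K M' N' K' : ℕ, IsSolution M N K → N ≤ M → 0 < N →
      IsSolution M' N' K' → N' < M' → 1 < N' →
      ∀ f g : LaurentRing k, SupportsNegativeCurve (IT M N K) (M + N) f →
        SupportsNegativeCurve (RT M' N' K') M' g → ¬ IsomorphicCurves f g) :=
  ⟨fun _ _ _ h => ⟨h.exists_supportsNegativeCurve_IT, h.exists_supportsNegativeCurve_RT⟩,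
    fun _ _ _ _ _ _ h hNM hN h' hNM' hN' hne _ _ =>
      not_isomorphicCurves_IT h hNM hN h' hNM' hN' hne,
    fun _ _ _ _ _ _ h hNM hN h' hNM' hN' hne _ _ =>
      not_isomorphicCurves_RT h hNM hN h' hNM' hN' hne,
    fun _ _ _ _ _ _ h hNM hN h' hNM' hN' _ _ =>
      not_isomorphicCurves_IT_RT h hNM hN h' hNM' hN'⟩

end NegativeCurves

theorem theorem1p1 {k : Type*} [Field k] [IsAlgClosed k] [CharZero k] :
    -- each integral triangle, and each rational triangle with `M > 0`, supports a negative curve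
    (∀ M N K : ℕ, NegativeCurves.IsSolution M N K →
      (∃ f : NegativeCurves.LaurentRing k,
        NegativeCurves.SupportsNegativeCurve (NegativeCurves.IT M N K) (M + N) f) ∧
      (0 < M → ∃ f : NegativeCurves.LaurentRing k,
        NegativeCurves.SupportsNegativeCurve (NegativeCurves.RT M N K) M f)) ∧
    -- the curves of two different integral triangles are not isomorphic
    (∀ M N K M' N' K' : ℕ,
      NegativeCurves.IsSolution M N K → N ≤ M → 0 < N →
      NegativeCurves.IsSolution M' N' K' → N' ≤ M' → 0 < N' →
      (M, N) ≠ (M', N') →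
      ∀ f g : NegativeCurves.LaurentRing k,
        NegativeCurves.SupportsNegativeCurve (NegativeCurves.IT M N K) (M + N) f →
        NegativeCurves.SupportsNegativeCurve (NegativeCurves.IT M' N' K') (M' + N') g →
        ¬ NegativeCurves.IsomorphicCurves f g) ∧
    -- the curves of two different rational triangles are not isomorphic
    (∀ M N K M' N' K' : ℕ,
      NegativeCurves.IsSolution M N K → N < M → 1 < N →
      NegativeCurves.IsSolution M' N' K' → N' < M' → 1 < N' →
      (M, N) ≠ (M', N') →
      ∀ f g : NegativeCurves.LaurentRing k,
        NegativeCurves.SupportsNegativeCurve (NegativeCurves.RT M N K) M f →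
        NegativeCurves.SupportsNegativeCurve (NegativeCurves.RT M' N' K') M' g →
        ¬ NegativeCurves.IsomorphicCurves f g) ∧
    -- the curves of an integral and of a rational triangle are not isomorphic
    (∀ M N K M' N' K' : ℕ,
      NegativeCurves.IsSolution M N K → N ≤ M → 0 < N →
      NegativeCurves.IsSolution M' N' K' → N' < M' → 1 < N' →
      ∀ f g : NegativeCurves.LaurentRing k,
        NegativeCurves.SupportsNegativeCurve (NegativeCurves.IT M N K) (M + N) f →
        NegativeCurves.SupportsNegativeCurve (NegativeCurves.RT M' N' K') M' g →
        ¬ NegativeCurves.IsomorphicCurves f g) :=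
  have ⟨hex, hIT, hRT, hIT_RT⟩ := NegativeCurves.theorem1p1_general (k := k)
  ⟨hex, hIT, fun _ _ _ _ _ _ h hNM hN h' hNM' hN' =>
    hRT _ _ _ _ _ _ h hNM (zero_lt_one.trans hN) h' hNM' (zero_lt_one.trans hN'), hIT_RT⟩
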